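/- **Theorem 1.1.** For $n\ge 1$ let $K_n=\mathbb{Q}(\zeta_n)$ be the $n$-th cyclotomic field. Let $f$ be a random completely multiplicative function on the integral ideals (nonzero ideals of the ring of integers) of $K_n$: the values $f(\mathfrak p)$ at the nonzero prime ideals $\mathfrak p$ are independent, each equal to $1$ or $-1$ with probability $1/2$, and $f(\mathfrak a)=f(\mathfrak p_1)^{e_1}\cdots f(\mathfrak p_s)^{e_s}$ for $\mathfrak a=\mathfrak p_1^{e_1}\cdots\mathfrak p_s^{e_s}$. Put $$S_{x,K_n}=\sum_{N(\mathfrak a)\le x}\frac{f(\mathfrak a)}{N(\mathfrak a)},$$ where the sum runs over the integral ideals $\mathfrak a$ of $K_n$ of norm $N(\mathfrak a)\le x$. There is an absolute constant $M>0$ such that for every real $A>0$ there is a constant $C(A)>0$, depending only on $A$, with the following property: for all real $x\ge 3$ and all integers $n\ge 1$ with $n<(\ln x)^A$, $$\mathbb{P}\left(S_{x,K_n}<0\right)\le M\exp\left(-\exp\left(\frac{\ln x}{C(A)\,\ln\ln x}\right)\right).$$ -/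

import Mathlib

open scoped NumberField

noncomputable section

/-- The finite set of integral ideals `𝔞` (nonzero ideals of `𝓞 K`) with `N(𝔞) ≤ x`. -/
def idealsOfNormLE (K : Type*) [Field K] [NumberField K] (x : ℝ) : Finset (Ideal (𝓞 K)) :=
  Set.Finite.toFinset (s := {𝔞 : Ideal (𝓞 K) | 𝔞 ≠ ⊥ ∧ (Ideal.absNorm 𝔞 : ℝ) ≤ x})
    ((Ideal.finite_setOfPred_absNorm_le (S := 𝓞 K) ⌊x⌋₊).subset fun _ h => Nat.le_floor h.2)

/-- The weighted partial sum `∑_{N(𝔞) ≤ x} g(𝔞) / N(𝔞)` over integral ideals of `K`. -/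
def weightedPartialSum {K : Type*} [Field K] [NumberField K] (g : Ideal (𝓞 K) → ℝ) (x : ℝ) : ℝ :=
  ∑ 𝔞 ∈ idealsOfNormLE K x, g 𝔞 / (Ideal.absNorm 𝔞 : ℝ)

/-- `f` is a random completely multiplicative function on the integral ideals of `K`:
its values at the nonzero prime ideals are independent random variables, each equal to `1` and
to `-1` with probability `1/2`, and `f(·, ω)` is completely multiplicative for every `ω`. -/
structure IsRandomCompletelyMultiplicative {K : Type*} [Field K] [NumberField K]
    {Ω : Type*} [MeasurableSpace Ω] (P : MeasureTheory.Measure Ω)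
    (f : Ideal (𝓞 K) → Ω → ℝ) : Prop where
  measurable_prime (𝔭 : IsDedekindDomain.HeightOneSpectrum (𝓞 K)) : Measurable (f 𝔭.asIdeal)
  indep : ProbabilityTheory.iIndepFun
    (fun 𝔭 : IsDedekindDomain.HeightOneSpectrum (𝓞 K) => f 𝔭.asIdeal) P
  prob_one (𝔭 : IsDedekindDomain.HeightOneSpectrum (𝓞 K)) :
    P {ω | f 𝔭.asIdeal ω = 1} = 1 / 2
  prob_neg_one (𝔭 : IsDedekindDomain.HeightOneSpectrum (𝓞 K)) :
    P {ω | f 𝔭.asIdeal ω = -1} = 1 / 2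
  map_unit (ω : Ω) : f ⊤ ω = 1
  map_mul (𝔞 𝔟 : Ideal (𝓞 K)) (h𝔞 : 𝔞 ≠ ⊥) (h𝔟 : 𝔟 ≠ ⊥) (ω : Ω) :
    f (𝔞 * 𝔟) ω = f 𝔞 ω * f 𝔟 ω

end

set_option linter.unusedSectionVars false

section

open Finset IsDedekindDomain

/-! Write Λ = log x, l = log Λ. The primes are split at y = exp(Λ/(c l)), where c depends only on A.

The ideals built from primes of norm at most y contribute at least 1/(2E), where E = Λ^κ, almost
surely. Indeed their full Euler product is at least exp(-∑ 1/N(𝔭)), whatever the signs, and Rankin's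
trick makes the part of norm beyond x negligible (`exp_neg_sub_le_sum_supportedIdeals`).

The primes of norm in (y, x] are then added one at a time. Adding 𝔭 changes the sum by f(𝔭)X + R,
where X and R involve only the primes already present. With L = ∑ 1/N(𝔞) over N(𝔞) ≤ x, almost
surely |X| ≤ L/N(𝔭) and |R| ≤ L/N(𝔭)². As f(𝔭) is a fair sign independent of X, a Hoeffding-type
bound multiplies the exponential moment by a factor governed by 1/N(𝔭)²
(`integral_exp_supportedPartialSum_le`). Since ∑ 1/N(𝔭)² over N(𝔭) > y is at most y⁻¹ ∑ 1/N(𝔭),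
Chernoff's inequality with parameter √y bounds the probability of negativity by exp(-y^(1/4)).

The only arithmetic input is ∑ 1/N(𝔭) ≤ κ l over N(𝔭) ≤ x, with κ depending on A alone; it also
gives L ≤ E². In the n-th cyclotomic field, an unramified prime has norm a prime power q ≡ 1 mod n,
and at most φ(n) primes share a norm. The factor φ(n) has to be cancelled uniformly in n, which is
what a Brun–Titchmarsh inequality does; it is proved here by Selberg's sieve. Small moduli of
summation and ramified primes cost O(log n), hence O(A l). -/

noncomputable section

/-! ### Selberg's sieve in the progression 1 mod n. -/

/-- The squarefree integers `1 ≤ d ≤ z` coprime to `n`. -/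
def selbergSupport (n z : ℕ) : Finset ℕ :=
  (Finset.Icc 1 z).filter fun d => Squarefree d ∧ d.Coprime n

theorem mem_selbergSupport {n z d : ℕ} :
    d ∈ selbergSupport n z ↔ (1 ≤ d ∧ d ≤ z) ∧ Squarefree d ∧ d.Coprime n := by
  simp [selbergSupport]

theorem selbergSupport_of_dvd {n z d m : ℕ} (hm : m ∈ selbergSupport n z) (hd : d ∣ m) :
    d ∈ selbergSupport n z := by
  rw [mem_selbergSupport] at *
  obtain ⟨⟨h1, h2⟩, h3, h4⟩ := hm
  exact ⟨⟨Nat.pos_of_dvd_of_pos hd h1, (Nat.le_of_dvd h1 hd).trans h2⟩,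
    h3.squarefree_of_dvd hd, h4.coprime_dvd_left hd⟩

theorem one_mem_selbergSupport {n z : ℕ} (hz : 1 ≤ z) : 1 ∈ selbergSupport n z := by
  simp [mem_selbergSupport, hz]

/-- The sum of `1 / m` over the support of the sieve. -/
def selbergMass (n z : ℕ) : ℝ := ∑ m ∈ selbergSupport n z, (m : ℝ)⁻¹

theorem selbergMass_pos {n z : ℕ} (hz : 1 ≤ z) : 0 < selbergMass n z := by
  refine sum_pos (fun m hm => ?_) ⟨1, one_mem_selbergSupport hz⟩
  have := (mem_selbergSupport.1 hm).1.1
  positivity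

/-- The diagonalised sieve weights. -/
def selbergDiag (n z m : ℕ) : ℝ := (ArithmeticFunction.moebius m : ℝ) / (m * selbergMass n z)

/-- The weights of the quadratic sieve. -/
def selbergWeight (n z d : ℕ) : ℝ :=
  d * ∑ m ∈ selbergSupport n z with d ∣ m,
    (ArithmeticFunction.moebius (m / d) : ℝ) * selbergDiag n z m

/-- Putting e = l / d leaves the sum of μ(e) over the divisors of l / m. This is the Möbius
inversion that recovers the diagonal variables from the weights. -/
theorem sum_moebius_div_eq {m l : ℕ} (hl : l ≠ 0) (hml : m ∣ l) :
    ∑ d ∈ l.divisors with m ∣ d, (ArithmeticFunction.moebius (l / d) : ℝ) =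
      if l = m then 1 else 0 := by
  have hm : m ≠ 0 := ne_zero_of_dvd_ne_zero hl hml
  have key : ∑ d ∈ l.divisors with m ∣ d, (ArithmeticFunction.moebius (l / d) : ℝ) =
      ∑ e ∈ (l / m).divisors, (ArithmeticFunction.moebius e : ℝ) := by
    obtain ⟨k, rfl⟩ := hml
    have hk : k ≠ 0 := right_ne_zero_of_mul hl
    have hdk : m * k / m = k := Nat.mul_div_cancel_left _ (Nat.pos_of_ne_zero hm)
    rw [hdk]
    refine sum_nbij' (fun d => m * k / d) (fun e => m * k / e) ?_ ?_ ?_ ?_ ?_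
    · intro d hd
      simp only [mem_filter, Nat.mem_divisors] at hd
      obtain ⟨⟨hd, -⟩, a, rfl⟩ := hd
      have ha : a ∣ k := Nat.dvd_of_mul_dvd_mul_left (Nat.pos_of_ne_zero hm) hd
      simp only [Nat.mem_divisors]
      rw [Nat.mul_div_mul_left _ _ (Nat.pos_of_ne_zero hm)]
      exact ⟨Nat.div_dvd_of_dvd ha, hk⟩
    · intro e he
      simp only [Nat.mem_divisors] at he
      simp only [mem_filter, Nat.mem_divisors]
      refine ⟨⟨Nat.div_dvd_of_dvd (he.1.mul_left _), hl⟩, ?_⟩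
      rw [Nat.mul_div_assoc _ he.1]
      exact dvd_mul_right _ _
    · intro d hd
      simp only [mem_filter, Nat.mem_divisors] at hd
      exact Nat.div_div_self hd.1.1 hl
    · intro e he
      simp only [Nat.mem_divisors] at he
      exact Nat.div_div_self (he.1.mul_left _) hl
    · intro d _; rfl
  rw [key]
  have h := congrArg (fun f : ArithmeticFunction ℤ => f (l / m))
    ArithmeticFunction.coe_zeta_mul_moebius
  simp only [ArithmeticFunction.coe_zeta_mul_apply, ArithmeticFunction.one_apply] at h
  have h2 : (l / m = 1) ↔ l = m := by
    constructor
    · intro h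
      rw [← Nat.div_mul_cancel hml, h, one_mul]
    · rintro rfl
      exact Nat.div_self (Nat.pos_of_ne_zero hm)
  rw [← Int.cast_sum, h]
  simp only [h2]
  split_ifs <;> simp

theorem selbergWeight_one {n z : ℕ} (hz : 1 ≤ z) : selbergWeight n z 1 = 1 := by
  have hW := (selbergMass_pos (n := n) hz).ne'
  simp only [selbergWeight, selbergDiag, one_dvd, filter_true, Nat.div_one, Nat.cast_one, one_mul]
  have : ∀ m ∈ selbergSupport n z, (ArithmeticFunction.moebius m : ℝ) *
      ((ArithmeticFunction.moebius m : ℝ) / (m * selbergMass n z)) =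
      (m : ℝ)⁻¹ * (selbergMass n z)⁻¹ := by
    intro m hm
    have h := ArithmeticFunction.moebius_sq_eq_one_of_squarefree (mem_selbergSupport.1 hm).2.1
    have h' : (ArithmeticFunction.moebius m : ℝ) ^ 2 = 1 := by exact_mod_cast h
    rw [mul_div_assoc', ← sq, h', one_div, mul_inv]
  rw [sum_congr rfl this, ← sum_mul]
  exact mul_inv_cancel₀ hW

/-- Both Möbius factors are at most 1 in absolute value, and the remaining sum of 1/m is normalised
by the mass. A bound linear in d costs only a power of z in the error term, which is affordable. -/
theorem abs_selbergWeight_le {n z d : ℕ} (hz : 1 ≤ z) : |selbergWeight n z d| ≤ d := by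
  have hW := selbergMass_pos (n := n) hz
  rw [selbergWeight, abs_mul, Nat.abs_cast]
  refine mul_le_of_le_one_right (Nat.cast_nonneg d) ?_
  calc _ ≤ ∑ m ∈ selbergSupport n z with d ∣ m,
        |(ArithmeticFunction.moebius (m / d) : ℝ) * selbergDiag n z m| := abs_sum_le_sum_abs _ _
    _ ≤ ∑ m ∈ selbergSupport n z with d ∣ m, (m : ℝ)⁻¹ * (selbergMass n z)⁻¹ := by
        refine sum_le_sum fun m hm => ?_
        have h1 : |(ArithmeticFunction.moebius (m / d) : ℝ)| ≤ 1 := by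
          exact_mod_cast ArithmeticFunction.abs_moebius_le_one
        have h2 : |(ArithmeticFunction.moebius m : ℝ)| ≤ 1 := by
          exact_mod_cast ArithmeticFunction.abs_moebius_le_one
        rw [selbergDiag, abs_mul, abs_div, abs_mul, Nat.abs_cast, abs_of_pos hW,
          ← mul_inv, div_eq_mul_inv]
        have : (0 : ℝ) ≤ (m * selbergMass n z)⁻¹ := by positivity
        nlinarith [mul_le_mul h1 h2 (abs_nonneg _) zero_le_one, abs_nonneg
          (ArithmeticFunction.moebius (m / d) : ℝ), abs_nonneg (ArithmeticFunction.moebius m : ℝ)]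
    _ ≤ ∑ m ∈ selbergSupport n z, (m : ℝ)⁻¹ * (selbergMass n z)⁻¹ :=
        sum_le_sum_of_subset_of_nonneg (filter_subset _ _) fun _ _ _ => by positivity
    _ = 1 := by
        rw [← sum_mul]
        exact mul_inv_cancel₀ hW.ne'

theorem sum_selbergWeight_div {n z m : ℕ} (hm : m ∈ selbergSupport n z) :
    ∑ d ∈ selbergSupport n z with m ∣ d, selbergWeight n z d / d = selbergDiag n z m := by
  have h1 : ∀ d ∈ (selbergSupport n z).filter (m ∣ ·), selbergWeight n z d / d =
      ∑ l ∈ selbergSupport n z, if d ∣ l then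
        (ArithmeticFunction.moebius (l / d) : ℝ) * selbergDiag n z l else 0 := by
    intro d hd
    have hd0 : (d : ℝ) ≠ 0 := by
      have := (mem_selbergSupport.1 (mem_filter.1 hd).1).1.1
      positivity
    rw [selbergWeight, mul_div_cancel_left₀ _ hd0, sum_filter]
  rw [sum_congr rfl h1, sum_comm]
  have h2 : ∀ l ∈ selbergSupport n z, (∑ d ∈ (selbergSupport n z).filter (m ∣ ·), if d ∣ l then
        (ArithmeticFunction.moebius (l / d) : ℝ) * selbergDiag n z l else 0) =
      if l = m then selbergDiag n z l else 0 := by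
    intro l hl
    have hl0 : l ≠ 0 := by have := (mem_selbergSupport.1 hl).1.1; omega
    rw [← sum_filter, ← sum_mul]
    by_cases hml : m ∣ l
    · have : ((selbergSupport n z).filter (m ∣ ·)).filter (· ∣ l) =
          l.divisors.filter (m ∣ ·) := by
        ext d
        simp only [mem_filter, Nat.mem_divisors]
        exact ⟨fun h => ⟨⟨h.2, hl0⟩, h.1.2⟩,
          fun h => ⟨⟨selbergSupport_of_dvd hl h.1.1, h.2⟩, h.1.1⟩⟩
      rw [this, sum_moebius_div_eq hl0 hml]
      split_ifs <;> simp
    · have : ((selbergSupport n z).filter (m ∣ ·)).filter (· ∣ l) = ∅ := by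
        rw [filter_eq_empty_iff]
        intro d hd hdl
        exact hml ((mem_filter.1 hd).2.trans hdl)
      rw [this, sum_empty, zero_mul, if_neg]
      rintro rfl
      exact hml dvd_rfl
  rw [sum_congr rfl h2, sum_ite_eq' _ _ _, if_pos hm]

/-- Since 1/lcm(d, e) = gcd(d, e)/(de) and gcd(d, e) is the sum of φ(m) over its divisors m, the
quadratic form becomes ∑ φ(m) y_m² in the variables y_m = `selbergDiag n z m`. The optimal y_m would
have φ(m) in place of m; the present choice and φ(m) ≤ m already give the inverse mass, and keep the
mass elementary. -/
theorem sum_selbergWeight_mul_div_lcm_le {n z : ℕ} (hz : 1 ≤ z) :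
    ∑ d ∈ selbergSupport n z, ∑ e ∈ selbergSupport n z,
      selbergWeight n z d * selbergWeight n z e / (d.lcm e : ℕ) ≤ (selbergMass n z)⁻¹ := by
  have hW := selbergMass_pos (n := n) hz
  set D := selbergSupport n z with hD
  have h1 : ∀ d ∈ D, ∀ e ∈ D, selbergWeight n z d * selbergWeight n z e / (d.lcm e : ℕ) =
      ∑ m ∈ D, (m.totient : ℝ) * ((if m ∣ d then selbergWeight n z d / d else 0) *
        (if m ∣ e then selbergWeight n z e / e else 0)) := by
    intro d hd e he
    have hd1 := (mem_selbergSupport.1 hd).1.1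
    have he1 := (mem_selbergSupport.1 he).1.1
    have hd0 : (d : ℝ) ≠ 0 := by positivity
    have he0 : (e : ℝ) ≠ 0 := by positivity
    have hg : ∑ m ∈ D with m ∣ d ∧ m ∣ e, (m.totient : ℝ) = (d.gcd e : ℕ) := by
      rw [← Nat.sum_totient (d.gcd e), Nat.cast_sum]
      refine sum_congr ?_ fun _ _ => rfl
      ext m
      simp only [mem_filter, Nat.mem_divisors, Nat.dvd_gcd_iff]
      refine ⟨fun h => ⟨h.2, ?_⟩, fun h => ⟨selbergSupport_of_dvd hd h.1.1, h.1⟩⟩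
      exact (Nat.gcd_pos_of_pos_left _ hd1).ne'
    have hl : ((d.gcd e : ℕ) : ℝ) * (d.lcm e : ℕ) = d * e := by exact_mod_cast Nat.gcd_mul_lcm d e
    have hl0 : ((d.lcm e : ℕ) : ℝ) ≠ 0 := by
      have := Nat.lcm_pos hd1 he1
      positivity
    calc _ = ((d.gcd e : ℕ) : ℝ) * (selbergWeight n z d / d * (selbergWeight n z e / e)) := by
          field_simp
          linear_combination (-selbergWeight n z d * selbergWeight n z e) * hl
      _ = _ := by
          rw [← hg, sum_mul, sum_filter]
          refine sum_congr rfl fun m _ => ?_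
          by_cases h : m ∣ d <;> by_cases h' : m ∣ e <;> simp [h, h']
  rw [sum_congr rfl fun d hd => sum_congr rfl fun e he => h1 d hd e he]
  have h2 : ∑ d ∈ D, ∑ e ∈ D, ∑ m ∈ D, (m.totient : ℝ) *
      ((if m ∣ d then selbergWeight n z d / d else 0) *
        (if m ∣ e then selbergWeight n z e / e else 0)) =
      ∑ m ∈ D, (m.totient : ℝ) * selbergDiag n z m ^ 2 := by
    rw [sum_congr rfl fun d _ => sum_comm, sum_comm]
    refine sum_congr rfl fun m hm => ?_
    rw [sq, ← sum_selbergWeight_div hm, sum_filter, sum_mul_sum, mul_sum]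
    exact sum_congr rfl fun d _ => (mul_sum ..).symm
  rw [h2]
  calc _ ≤ ∑ m ∈ D, (m : ℝ)⁻¹ * ((selbergMass n z)⁻¹ * (selbergMass n z)⁻¹) := by
        refine sum_le_sum fun m hm => ?_
        have hm1 := (mem_selbergSupport.1 hm).1.1
        have h := ArithmeticFunction.moebius_sq_eq_one_of_squarefree (mem_selbergSupport.1 hm).2.1
        have h' : (ArithmeticFunction.moebius m : ℝ) ^ 2 = 1 := by exact_mod_cast h
        have ht : (m.totient : ℝ) ≤ m := by exact_mod_cast Nat.totient_le m
        rw [selbergDiag, div_pow, h']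
        have : (m : ℝ)⁻¹ * ((selbergMass n z)⁻¹ * (selbergMass n z)⁻¹) =
            m * (1 / (m * selbergMass n z) ^ 2) := by field_simp
        rw [this]
        exact mul_le_mul_of_nonneg_right ht (by positivity)
    _ = (selbergMass n z)⁻¹ := by
        rw [← sum_mul]
        change selbergMass n z * _ = _
        field_simp

/-- As n is invertible modulo D, the condition on k is a single residue class modulo D. -/
theorem abs_card_dvd_sub_le {n D : ℕ} (hD : D ≠ 0) (h : D.Coprime n) (a H : ℕ) :
    |(#{k ∈ Ico a (a + H) | D ∣ n * k + 1} : ℝ) - H / D| ≤ 1 := by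
  obtain ⟨v, hv⟩ : ∃ v : ℕ, ∀ k, D ∣ n * k + 1 ↔ k ≡ v [MOD D] := by
    have : NeZero D := ⟨hD⟩
    let u := ZMod.unitOfCoprime n h.symm
    refine ⟨(-(↑u⁻¹ : ZMod D)).val, fun k => ?_⟩
    rw [← ZMod.natCast_eq_natCast_iff, ← ZMod.natCast_eq_zero_iff, ZMod.natCast_zmod_val]
    push_cast
    have hu : (n : ZMod D) = u := (ZMod.coe_unitOfCoprime n h.symm).symm
    rw [hu, eq_neg_iff_add_eq_zero]
    constructor
    · intro hk
      have := congrArg (fun t => (↑u⁻¹ : ZMod D) * t) hk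
      simpa [mul_add] using this
    · intro hk
      have := congrArg (fun t => (u : ZMod D) * t) hk
      simpa [mul_add] using this
  have hcard := Nat.Ico_filter_modEq_card a (a + H) (Nat.pos_of_ne_zero hD) v
  simp only [hv]
  have hD' : (0 : ℚ) < D := by exact_mod_cast Nat.pos_of_ne_zero hD
  set X : ℚ := ((a + H : ℕ) - v) / D with hX
  set Y : ℚ := ((a : ℕ) - v) / D with hY
  have hXY : X - Y = H / D := by
    rw [hX, hY]; push_cast; field_simp; ring
  have hge : Y ≤ X := by
    have : (0 : ℚ) ≤ H / D := by positivity
    linarith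
  rw [max_eq_left (sub_nonneg.2 (Int.ceil_mono hge))] at hcard
  have hq : |(#{k ∈ Ico a (a + H) | k ≡ v [MOD D]} : ℚ) - H / D| ≤ 1 := by
    have : (#{k ∈ Ico a (a + H) | k ≡ v [MOD D]} : ℚ) = (⌈X⌉ : ℚ) - ⌈Y⌉ := by exact_mod_cast hcard
    rw [this, ← hXY, abs_le]
    constructor <;> linarith [Int.le_ceil X, Int.le_ceil Y, Int.ceil_lt_add_one X,
      Int.ceil_lt_add_one Y]
  have hr := (Rat.cast_le (K := ℝ)).2 hq
  push_cast at hr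
  convert hr

/-- Selberg's upper bound sieve for the progression `1 mod n`. -/
theorem card_sifted_le {n z : ℕ} (hz : 1 ≤ z) (a H : ℕ) (S : Finset ℕ) (hS : S ⊆ Ico a (a + H))
    (hsift : ∀ k ∈ S, ∀ d ∈ selbergSupport n z, d ∣ n * k + 1 → d = 1) :
    (#S : ℝ) ≤ H * (selbergMass n z)⁻¹ + z ^ 4 := by
  set D := selbergSupport n z with hD
  set w := selbergWeight n z with hw
  have hpos : ∀ d ∈ D, d ≠ 0 := fun d hd => by have := (mem_selbergSupport.1 hd).1.1; omega
  -- On the sifted set only d = 1 contributes, so F = w 1 = 1 there; elsewhere F² ≥ 0. Expanding F²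
  -- leads to divisibility by lcm(d, e), whose counting error of at most 1 is weighted by at most d
  -- e, giving z⁴ in total.
  let F : ℕ → ℝ := fun k => ∑ d ∈ D, if d ∣ n * k + 1 then w d else 0
  have h1 : (#S : ℝ) ≤ ∑ k ∈ Ico a (a + H), F k ^ 2 := by
    calc (#S : ℝ) = ∑ k ∈ S, F k ^ 2 := by
          rw [card_eq_sum_ones, Nat.cast_sum]
          refine sum_congr rfl fun k hk => ?_
          have : F k = 1 := by
            rw [← selbergWeight_one (n := n) hz, ← hw]
            change ∑ d ∈ D, _ = _
            rw [sum_eq_single_of_mem 1 (one_mem_selbergSupport hz)]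
            · simp
            · intro d hd hne
              rw [if_neg]
              exact fun h => hne (hsift k hk d hd h)
          rw [this]; norm_num
      _ ≤ _ := sum_le_sum_of_subset_of_nonneg hS fun _ _ _ => sq_nonneg _
  have h2 : ∑ k ∈ Ico a (a + H), F k ^ 2 = ∑ d ∈ D, ∑ e ∈ D,
      w d * w e * #{k ∈ Ico a (a + H) | d.lcm e ∣ n * k + 1} := by
    have : ∀ k, F k ^ 2 = ∑ d ∈ D, ∑ e ∈ D, w d * w e * if d.lcm e ∣ n * k + 1 then 1 else 0 := by
      intro k
      change (∑ d ∈ D, _) ^ 2 = _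
      rw [sq, sum_mul_sum]
      refine sum_congr rfl fun d _ => sum_congr rfl fun e _ => ?_
      by_cases h : d ∣ n * k + 1 <;> by_cases h' : e ∣ n * k + 1 <;>
        simp [Nat.lcm_dvd_iff, h, h']
    rw [sum_congr rfl fun k _ => this k, sum_comm]
    refine sum_congr rfl fun d _ => ?_
    rw [sum_comm]
    refine sum_congr rfl fun e _ => ?_
    rw [← mul_sum, sum_boole]
  have h3 : ∑ d ∈ D, ∑ e ∈ D, w d * w e * #{k ∈ Ico a (a + H) | d.lcm e ∣ n * k + 1} ≤
      ∑ d ∈ D, ∑ e ∈ D, (H * (w d * w e / (d.lcm e : ℕ)) + (d : ℝ) * e) := by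
    refine sum_le_sum fun d hd => sum_le_sum fun e he => ?_
    have hc : (d.lcm e).Coprime n :=
      Nat.Coprime.coprime_dvd_left (Nat.lcm_dvd_mul d e)
        (Nat.Coprime.mul_left (mem_selbergSupport.1 hd).2.2 (mem_selbergSupport.1 he).2.2)
    have hb := abs_card_dvd_sub_le (Nat.lcm_ne_zero (hpos d hd) (hpos e he)) hc a H
    set N : ℝ := (#{k ∈ Ico a (a + H) | d.lcm e ∣ n * k + 1} : ℝ) with hN
    have hww : |w d * w e| ≤ (d : ℝ) * e := by
      rw [abs_mul]
      exact mul_le_mul (abs_selbergWeight_le hz) (abs_selbergWeight_le hz) (abs_nonneg _)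
        (Nat.cast_nonneg _)
    have : w d * w e * (N - H / (d.lcm e : ℕ)) ≤ (d : ℝ) * e := by
      refine (le_abs_self _).trans ?_
      rw [abs_mul]
      calc _ ≤ (d : ℝ) * e * 1 := mul_le_mul hww hb (abs_nonneg _) (by positivity)
        _ = _ := mul_one _
    have h5 : H * (w d * w e / (d.lcm e : ℕ)) = w d * w e * (H / (d.lcm e : ℕ)) := by ring
    rw [h5]
    linarith [mul_sub (w d * w e) N (H / (d.lcm e : ℕ))]
  have h4 : ∑ d ∈ D, ∑ e ∈ D, (H * (w d * w e / (d.lcm e : ℕ)) + (d : ℝ) * e) =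
      H * ∑ d ∈ D, ∑ e ∈ D, w d * w e / (d.lcm e : ℕ) + (∑ d ∈ D, (d : ℝ)) ^ 2 := by
    rw [sq, sum_mul_sum, mul_sum, ← sum_add_distrib]
    refine sum_congr rfl fun d _ => ?_
    rw [mul_sum, ← sum_add_distrib]
  have h5 : ∑ d ∈ D, (d : ℝ) ≤ z ^ 2 := by
    calc ∑ d ∈ D, (d : ℝ) ≤ ∑ d ∈ D, (z : ℝ) :=
          sum_le_sum fun d hd => by exact_mod_cast (mem_selbergSupport.1 hd).1.2
      _ = #D * (z : ℝ) := by simp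
      _ ≤ z * z := by
          refine mul_le_mul_of_nonneg_right ?_ (Nat.cast_nonneg _)
          have : #D ≤ #(Icc 1 z) := card_filter_le _ _
          rw [Nat.card_Icc, Nat.add_sub_cancel] at this
          exact_mod_cast this
      _ = z ^ 2 := by ring
  have h6 : (∑ d ∈ D, (d : ℝ)) ^ 2 ≤ ((z : ℝ) ^ 2) ^ 2 :=
    pow_le_pow_left₀ (sum_nonneg fun _ _ => Nat.cast_nonneg _) h5 2
  have h7 := mul_le_mul_of_nonneg_left (sum_selbergWeight_mul_div_lcm_le (n := n) hz)
    (Nat.cast_nonneg (α := ℝ) H)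
  calc (#S : ℝ) ≤ _ := h1
    _ = _ := h2
    _ ≤ _ := h3
    _ = _ := h4
    _ ≤ _ := add_le_add h7 (h6.trans_eq (by ring))

end

/-! ### Lower bound for the sieve mass. -/

theorem sum_squarefree_divisors_inv_mul_totient_le {n : ℕ} (hn : n ≠ 0) :
    (∑ d ∈ n.divisors with Squarefree d, (d : ℝ)⁻¹) * n.totient ≤ n := by
  have h1 : ∑ d ∈ n.divisors with Squarefree d, (d : ℝ)⁻¹ =
      ∏ p ∈ n.primeFactors, (1 + (p : ℝ)⁻¹) := by
    have hs : (UniqueFactorizationMonoid.normalizedFactors n).toFinset = n.primeFactors := by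
      rw [Nat.factors_eq]; rfl
    rw [Nat.sum_divisors_filter_squarefree hn, prod_one_add, hs]
    refine sum_congr rfl fun t _ => ?_
    rw [Finset.prod_inv_distrib, ← Nat.cast_prod]
    congr 2
    exact (Finset.prod_val t)
  have h2 : (n.totient : ℝ) = n * ∏ p ∈ n.primeFactors, (1 - (p : ℝ)⁻¹) := by
    have := congrArg (fun q : ℚ => (q : ℝ)) (Nat.totient_eq_mul_prod_factors n)
    push_cast at this
    exact this
  rw [h1, h2, mul_left_comm, ← prod_mul_distrib]
  refine mul_le_of_le_one_right (Nat.cast_nonneg n) (prod_le_one (fun p hp => ?_) fun p hp => ?_)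
  all_goals
    have hp1 : (p : ℝ)⁻¹ ≤ 1 := inv_le_one_of_one_le₀
      (by exact_mod_cast (Nat.prime_of_mem_primeFactors hp).one_lt.le)
    have hp0 : (0 : ℝ) ≤ (p : ℝ)⁻¹ := by positivity
    nlinarith

/-- The map l ↦ (gcd(l, n), l / gcd(l, n)) is injective, and its second entry is coprime to n
because l is squarefree. The coprimality condition is thus removed at the price of ∏ (1 + 1/p) over
p ∣ n, which is at most n/φ(n). -/
theorem sum_squarefree_inv_le {n z : ℕ} (hn : n ≠ 0) :
    ∑ l ∈ Icc 1 z with Squarefree l, (l : ℝ)⁻¹ ≤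
      (∑ d ∈ n.divisors with Squarefree d, (d : ℝ)⁻¹) * selbergMass n z := by
  rw [selbergMass, sum_mul_sum, ← sum_product']
  let g : ℕ → ℕ × ℕ := fun l => (l.gcd n, l / l.gcd n)
  have hg : ∀ l, (g l).1 * (g l).2 = l := fun l => Nat.mul_div_cancel' (Nat.gcd_dvd_left l n)
  have hinj : Set.InjOn g ((Icc 1 z).filter Squarefree) := by
    intro a _ b _ h
    rw [← hg a, h, hg b]
  calc _ = ∑ l ∈ Icc 1 z with Squarefree l, (((g l).1 : ℝ)⁻¹ * ((g l).2 : ℝ)⁻¹) := by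
        refine sum_congr rfl fun l _ => ?_
        rw [← mul_inv, ← Nat.cast_mul, hg]
    _ = ∑ q ∈ ((Icc 1 z).filter Squarefree).image g, ((q.1 : ℝ)⁻¹ * (q.2 : ℝ)⁻¹) :=
        (sum_image (f := fun q : ℕ × ℕ => ((q.1 : ℝ)⁻¹ * (q.2 : ℝ)⁻¹)) hinj).symm
    _ ≤ _ := by
        refine sum_le_sum_of_subset_of_nonneg ?_ fun _ _ _ => by positivity
        intro q hq
        obtain ⟨l, hl, rfl⟩ := mem_image.1 hq
        simp only [mem_filter, mem_Icc] at hl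
        obtain ⟨⟨hl1, hl2⟩, hsq⟩ := hl
        have hsq' : Squarefree ((g l).1 * (g l).2) := by rw [hg]; exact hsq
        have hdvd2 : (g l).2 ∣ l := ⟨(g l).1, by rw [mul_comm, hg]⟩
        simp only [mem_product, mem_filter, Nat.mem_divisors, mem_selbergSupport]
        refine ⟨⟨⟨Nat.gcd_dvd_right l n, hn⟩, hsq'.of_mul_left⟩,
          ⟨Nat.pos_of_dvd_of_pos hdvd2 hl1, (Nat.le_of_dvd hl1 hdvd2).trans hl2⟩,
          hsq'.of_mul_right, ?_⟩
        have hco := Nat.coprime_of_squarefree_mul hsq'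
        have h1 : (g l).2.gcd n ∣ (g l).1 :=
          Nat.dvd_gcd ((Nat.gcd_dvd_left _ _).trans hdvd2) (Nat.gcd_dvd_right _ _)
        exact Nat.eq_one_of_dvd_coprimes hco h1 (Nat.gcd_dvd_left _ _)

/-- Each k is b² a with a squarefree, and ∑ 1/b² ≤ 2. -/
theorem sum_inv_le_two_mul_sum_squarefree_inv (z : ℕ) :
    ∑ k ∈ Icc 1 z, (k : ℝ)⁻¹ ≤ 2 * ∑ l ∈ Icc 1 z with Squarefree l, (l : ℝ)⁻¹ := by
  choose a b hab hsq using Nat.sq_mul_squarefree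
  have hz2 : ∑ m ∈ Icc 1 z, ((m : ℝ) ^ 2)⁻¹ ≤ 2 := by
    rcases Nat.eq_zero_or_pos z with rfl | hz
    · simp
    · have h := sum_Ioc_inv_sq_le_sub (α := ℝ) one_ne_zero hz
      rw [← Finset.add_sum_Ioc_eq_sum_Icc hz]
      have : (0 : ℝ) ≤ (z : ℝ)⁻¹ := by positivity
      norm_num at h ⊢
      linarith
  have hinj : Set.InjOn (fun k => (b k, a k)) (Icc 1 z : Finset ℕ) := by
    intro x _ y _ h
    simp only [Prod.mk.injEq] at h
    rw [← hab x, ← hab y, h.1, h.2]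
  calc ∑ k ∈ Icc 1 z, (k : ℝ)⁻¹ = ∑ k ∈ Icc 1 z, (((b k : ℝ) ^ 2)⁻¹ * (a k : ℝ)⁻¹) := by
        refine sum_congr rfl fun k _ => ?_
        rw [← mul_inv]
        congr 1
        exact_mod_cast (hab k).symm
    _ = ∑ q ∈ (Icc 1 z).image (fun k => (b k, a k)), (((q.1 : ℝ) ^ 2)⁻¹ * (q.2 : ℝ)⁻¹) :=
        (sum_image (f := fun q : ℕ × ℕ => (((q.1 : ℝ) ^ 2)⁻¹ * (q.2 : ℝ)⁻¹)) hinj).symm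
    _ ≤ ∑ q ∈ Icc 1 z ×ˢ (Icc 1 z).filter Squarefree, (((q.1 : ℝ) ^ 2)⁻¹ * (q.2 : ℝ)⁻¹) := by
        refine sum_le_sum_of_subset_of_nonneg ?_ fun _ _ _ => by positivity
        intro q hq
        obtain ⟨k, hk, rfl⟩ := mem_image.1 hq
        rw [mem_Icc] at hk
        have hb : b k ∣ k := ⟨b k * a k, by rw [← mul_assoc, ← sq, hab]⟩
        have ha : a k ∣ k := ⟨b k ^ 2, by rw [mul_comm, hab]⟩
        simp only [mem_product, mem_filter, mem_Icc]
        exact ⟨⟨Nat.pos_of_dvd_of_pos hb hk.1, (Nat.le_of_dvd hk.1 hb).trans hk.2⟩,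
          ⟨Nat.pos_of_dvd_of_pos ha hk.1, (Nat.le_of_dvd hk.1 ha).trans hk.2⟩, hsq k⟩
    _ = (∑ m ∈ Icc 1 z, ((m : ℝ) ^ 2)⁻¹) * ∑ l ∈ Icc 1 z with Squarefree l, (l : ℝ)⁻¹ := by
        rw [sum_mul_sum, ← sum_product']
    _ ≤ _ := mul_le_mul_of_nonneg_right hz2 (sum_nonneg fun _ _ => by positivity)

theorem totient_mul_log_le_selbergMass {n : ℕ} (hn : n ≠ 0) (z : ℕ) :
    n.totient * Real.log (z + 1) ≤ 2 * n * selbergMass n z := by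
  have h1 := log_add_one_le_harmonic z
  rw [harmonic_eq_sum_Icc] at h1
  push_cast at h1
  have h2 := sum_inv_le_two_mul_sum_squarefree_inv z
  have h3 := sum_squarefree_inv_le (z := z) hn
  have h4 := sum_squarefree_divisors_inv_mul_totient_le hn
  have hm : 0 ≤ selbergMass n z := sum_nonneg fun _ _ => by positivity
  have ht : (0 : ℝ) ≤ n.totient := Nat.cast_nonneg _
  calc _ ≤ n.totient * (2 * ((∑ d ∈ n.divisors with Squarefree d, (d : ℝ)⁻¹) * selbergMass n z)) :=
        mul_le_mul_of_nonneg_left (by linarith) ht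
    _ = 2 * selbergMass n z * ((∑ d ∈ n.divisors with Squarefree d, (d : ℝ)⁻¹) * n.totient) := by
        ring
    _ ≤ 2 * selbergMass n z * n := mul_le_mul_of_nonneg_left h4 (by positivity)
    _ = _ := by ring

/-! ### Brun–Titchmarsh and reciprocal sums of prime powers congruent to 1 mod n. -/

/-- A Brun–Titchmarsh inequality for primes congruent to `1` modulo `n`. -/
theorem card_primes_modEq_one_mul_le {n N : ℕ} (hn : 1 ≤ n) (hN : 2 ≤ N) (hnN : n ^ 4 ≤ N) :
    (#{p ∈ Ioc N (2 * N) | p.Prime ∧ p ≡ 1 [MOD n]} : ℝ) * (n.totient * Real.log N) ≤ 52 * N := by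
  have hN0 : (0 : ℝ) < N := by positivity
  have hN1 : (1 : ℝ) ≤ N := by exact_mod_cast (by omega : 1 ≤ N)
  have hn0 : (0 : ℝ) < n := by positivity
  -- With sieve level z = ⌊r⌋ the error z⁴ is at most r⁴, while n ≤ r² and log N = 8 log r ≤ 4 r².
  -- The error times φ(n) log N is therefore at most 4 r⁸ = 4 N; the main term gives 48 N.
  set r : ℝ := (N : ℝ) ^ (1 / 8 : ℝ) with hr
  have hr1 : 1 ≤ r := Real.one_le_rpow hN1 (by norm_num)
  have hr8 : r ^ 8 = N := by
    rw [hr, ← Real.rpow_natCast, ← Real.rpow_mul hN0.le]; norm_num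
  have hlog : Real.log N = 8 * Real.log r := by
    rw [← hr8, Real.log_pow]; norm_num
  set z := ⌊r⌋₊ with hz
  have hz1 : 1 ≤ z := Nat.one_le_floor_iff _ |>.2 hr1
  have hzr : (z : ℝ) ≤ r := Nat.floor_le (by linarith)
  have hzN : z ≤ N := by
    have : r ≤ r ^ 8 := le_self_pow₀ hr1 (by norm_num)
    exact_mod_cast (hzr.trans (this.trans_eq hr8))
  set a := N / n with ha
  set H := 2 * N / n - N / n + 1 with hH
  set P := {p ∈ Ioc N (2 * N) | p.Prime ∧ p ≡ 1 [MOD n]} with hP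
  have hform : ∀ p ∈ P, n * ((p - 1) / n) + 1 = p := by
    intro p hp
    simp only [hP, mem_filter] at hp
    have h1 : 1 ≤ p := hp.2.1.one_lt.le
    have := Nat.mul_div_cancel' ((Nat.modEq_iff_dvd' h1).1 hp.2.2.symm)
    omega
  set S := P.image fun p => (p - 1) / n with hS
  have hcard : #S = #P := by
    refine card_image_of_injOn fun p hp q hq h => ?_
    rw [← hform p hp, ← hform q hq]
    rw [h]
  have hle : N / n ≤ 2 * N / n := Nat.div_le_div_right (by omega)
  have hsub : S ⊆ Ico a (a + H) := by
    intro k hk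
    obtain ⟨p, hp, rfl⟩ := mem_image.1 hk
    simp only [hP, mem_filter, mem_Ioc] at hp
    rw [mem_Ico]
    have h1 : N / n ≤ (p - 1) / n := Nat.div_le_div_right (by omega)
    have h2 : (p - 1) / n ≤ 2 * N / n := Nat.div_le_div_right (by omega)
    omega
  have hsift : ∀ k ∈ S, ∀ d ∈ selbergSupport n z, d ∣ n * k + 1 → d = 1 := by
    intro k hk d hd hdk
    obtain ⟨p, hp, rfl⟩ := mem_image.1 hk
    rw [hform p hp] at hdk
    simp only [hP, mem_filter, mem_Ioc] at hp
    have := (mem_selbergSupport.1 hd).1.2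
    rcases (Nat.dvd_prime hp.2.1).1 hdk with h | h
    · exact h
    · omega
  have hmain := card_sifted_le hz1 a H S hsub hsift
  rw [hcard] at hmain
  have hW := selbergMass_pos (n := n) hz1
  have hmass := totient_mul_log_le_selbergMass (n := n) (by omega) z
  have hlogz : Real.log r ≤ Real.log (z + 1) :=
    Real.log_le_log (by linarith) (Nat.lt_floor_add_one r).le
  have ht : (0 : ℝ) ≤ n.totient := Nat.cast_nonneg _
  have hlr : 0 ≤ Real.log r := Real.log_nonneg hr1
  have hHn : (H : ℝ) * n ≤ 3 * N := by
    have hnN' : n ≤ N := (Nat.le_self_pow (by norm_num) n).trans hnN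
    have h1 : 2 * N / n ≤ N / n + N / n + 1 := by
      have e1 := Nat.div_add_mod N n
      have e2 := Nat.mod_lt N hn
      apply Nat.le_of_lt_succ
      rw [Nat.div_lt_iff_lt_mul hn]
      nlinarith
    have h2 : H * n ≤ 3 * N := by
      have h3 : H ≤ N / n + 2 := by omega
      have h4 := Nat.div_mul_le_self N n
      nlinarith
    exact_mod_cast h2
  have hnr : (n : ℝ) ≤ r ^ 2 := by
    have : (n : ℝ) ^ 4 ≤ (r ^ 2) ^ 4 := by
      rw [← pow_mul, hr8]; exact_mod_cast hnN
    exact le_of_pow_le_pow_left₀ (by norm_num) (by positivity) this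
  have htn : (n.totient : ℝ) ≤ n := by exact_mod_cast Nat.totient_le n
  have hlogr : Real.log r ≤ r := (Real.log_le_sub_one_of_pos (by linarith)).trans (by linarith)
  have hz4 : (z : ℝ) ^ 4 ≤ r ^ 4 := pow_le_pow_left₀ (Nat.cast_nonneg z) hzr 4
  have e1 : (H : ℝ) * (selbergMass n z)⁻¹ * (n.totient * Real.log N) ≤ 48 * N := by
    rw [hlog, mul_assoc, ← div_eq_inv_mul, mul_div_assoc']
    rw [div_le_iff₀ hW]
    calc (H : ℝ) * (n.totient * (8 * Real.log r)) = 8 * H * (n.totient * Real.log r) := by ring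
      _ ≤ 8 * H * (2 * n * selbergMass n z) := by
          refine mul_le_mul_of_nonneg_left ?_ (by positivity)
          exact (mul_le_mul_of_nonneg_left hlogz ht).trans hmass
      _ = 16 * selbergMass n z * (H * n) := by ring
      _ ≤ 16 * selbergMass n z * (3 * N) := mul_le_mul_of_nonneg_left hHn (by positivity)
      _ = _ := by ring
  have e2 : (z : ℝ) ^ 4 * (n.totient * Real.log N) ≤ 4 * N := by
    have hlogr2 : Real.log r ≤ r ^ 2 / 2 := by
      have h := Real.log_le_sub_one_of_pos (show 0 < r ^ 2 by positivity)
      rw [Real.log_pow] at h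
      push_cast at h
      linarith
    calc (z : ℝ) ^ 4 * (n.totient * Real.log N) ≤ r ^ 4 * (r ^ 2 * (8 * (r ^ 2 / 2))) := by
          rw [hlog]
          gcongr
          exact htn.trans hnr
      _ = 4 * r ^ 8 := by ring
      _ = 4 * N := by rw [hr8]
  have hlN : 0 ≤ n.totient * Real.log N := mul_nonneg ht (Real.log_nonneg hN1)
  calc _ ≤ (H * (selbergMass n z)⁻¹ + z ^ 4) * (n.totient * Real.log N) :=
        mul_le_mul_of_nonneg_right hmain hlN
    _ ≤ _ := by rw [add_mul]; linarith

/-- Dyadic decomposition: Brun–Titchmarsh on (2^j, 2^(j+1)] bounds the block by 104/j. The cut at 2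
n⁴ ensures n⁴ ≤ 2^j in every nonempty block; using `Nat.log 2 (p - 1)` makes the blocks closed on
the right. -/
theorem totient_mul_sum_primes_modEq_one_le {n : ℕ} (hn : 1 ≤ n) (J : ℕ) :
    n.totient * ∑ p ∈ Ioc (2 * n ^ 4) (2 ^ J) with p.Prime ∧ p ≡ 1 [MOD n], (p : ℝ)⁻¹ ≤
      104 * ∑ j ∈ Icc 1 J, (j : ℝ)⁻¹ := by
  set P := (Ioc (2 * n ^ 4) (2 ^ J)).filter fun p => p.Prime ∧ p ≡ 1 [MOD n] with hP
  have hn4 : 1 ≤ n ^ 4 := Nat.one_le_pow _ _ hn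
  have hmem : ∀ p ∈ P, 2 ^ Nat.log 2 (p - 1) ≤ p - 1 ∧ p - 1 < 2 ^ (Nat.log 2 (p - 1) + 1) := by
    intro p hp
    simp only [hP, mem_filter, mem_Ioc] at hp
    exact ⟨Nat.pow_log_le_self 2 (by omega), Nat.lt_pow_succ_log_self (by norm_num) _⟩
  have hmaps : ∀ p ∈ P, Nat.log 2 (p - 1) ∈ Icc 1 J := by
    intro p hp
    have h := hmem p hp
    simp only [hP, mem_filter, mem_Ioc] at hp
    rw [mem_Icc]
    constructor
    · exact Nat.log_pos (by norm_num) (by omega)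
    · refine (Nat.log_lt_of_lt_pow (by omega) ?_).le
      omega
  rw [← sum_fiberwise_of_maps_to hmaps, mul_sum, mul_sum]
  refine sum_le_sum fun j hj => ?_
  rw [mem_Icc] at hj
  have hj0 : (0 : ℝ) < j := by exact_mod_cast hj.1
  rcases (P.filter fun p => Nat.log 2 (p - 1) = j).eq_empty_or_nonempty with he | ⟨p₀, hp₀⟩
  · rw [he, sum_empty, mul_zero]; positivity
  have hN : n ^ 4 ≤ 2 ^ j := by
    rw [mem_filter] at hp₀
    have h := (hmem p₀ hp₀.1).2
    have h1 := hp₀.1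
    simp only [hP, mem_filter, mem_Ioc] at h1
    rw [hp₀.2, pow_succ] at h
    omega
  have hbt := card_primes_modEq_one_mul_le hn
    (show 2 ≤ 2 ^ j from (Nat.le_self_pow (by omega) 2)) hN
  have hcard : (#(P.filter fun p => Nat.log 2 (p - 1) = j) : ℝ) ≤
      #{p ∈ Ioc (2 ^ j) (2 * 2 ^ j) | p.Prime ∧ p ≡ 1 [MOD n]} := by
    refine Nat.cast_le.2 (card_le_card fun p hp => ?_)
    rw [mem_filter] at hp
    have h := hmem p hp.1
    have h1 := hp.1
    simp only [hP, mem_filter, mem_Ioc] at h1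
    rw [hp.2, pow_succ] at h
    simp only [mem_filter, mem_Ioc]
    exact ⟨by omega, h1.2⟩
  have hlog2 : (1 / 2 : ℝ) ≤ Real.log 2 := by linarith [Real.log_two_gt_d9]
  push_cast at hbt
  rw [Real.log_pow] at hbt
  set c : ℝ := (#(P.filter fun p => Nat.log 2 (p - 1) = j) : ℝ) with hc
  have ht : (0 : ℝ) ≤ n.totient := Nat.cast_nonneg _
  have hsum : ∑ p ∈ P with Nat.log 2 (p - 1) = j, (p : ℝ)⁻¹ ≤ c * ((2 : ℝ) ^ j)⁻¹ := by
    rw [hc, ← nsmul_eq_mul]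
    refine sum_le_card_nsmul _ _ _ fun p hp => ?_
    rw [mem_filter] at hp
    have h := hmem p hp.1
    rw [hp.2] at h
    refine inv_anti₀ (by positivity) ?_
    have : 2 ^ j ≤ p := h.1.trans (Nat.sub_le _ _)
    exact_mod_cast this
  have hfin : c * (n.totient * (j * (1 / 2))) ≤ 52 * 2 ^ j := by
    refine le_trans ?_ hbt
    gcongr
  calc n.totient * ∑ p ∈ P with Nat.log 2 (p - 1) = j, (p : ℝ)⁻¹
      ≤ n.totient * (c * ((2 : ℝ) ^ j)⁻¹) := mul_le_mul_of_nonneg_left hsum ht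
    _ = (c * (n.totient * (j * (1 / 2)))) * (2 * ((2 : ℝ) ^ j)⁻¹ * (j : ℝ)⁻¹) := by
        field_simp
    _ ≤ (52 * 2 ^ j) * (2 * ((2 : ℝ) ^ j)⁻¹ * (j : ℝ)⁻¹) :=
        mul_le_mul_of_nonneg_right hfin (by positivity)
    _ = 104 * (j : ℝ)⁻¹ := by
        field_simp
        norm_num

/-- In this range Brun–Titchmarsh is not available, and primality is dropped: q = nk + 1 gives 1/q ≤
1/(nk), φ(n) ≤ n cancels the factor n, and a harmonic sum up to 2 n³ remains. -/
theorem totient_mul_sum_modEq_one_small_le {n : ℕ} (hn : 1 ≤ n) :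
    n.totient * ∑ q ∈ Icc 2 (2 * n ^ 4) with q ≡ 1 [MOD n], (q : ℝ)⁻¹ ≤
      2 + 3 * Real.log n := by
  have hn0 : (0 : ℝ) < n := by positivity
  have hn1 : (1 : ℝ) ≤ n := by exact_mod_cast hn
  set P := (Icc 2 (2 * n ^ 4)).filter fun q => q ≡ 1 [MOD n] with hP
  have hform : ∀ q ∈ P, n * ((q - 1) / n) + 1 = q := by
    intro q hq
    simp only [hP, mem_filter, mem_Icc] at hq
    have h1 : 1 ≤ q := by omega
    have := Nat.mul_div_cancel' ((Nat.modEq_iff_dvd' h1).1 hq.2.symm)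
    omega
  have hinj : Set.InjOn (fun q => (q - 1) / n) P := by
    intro p hp q hq h
    rw [← hform p hp, ← hform q hq]
    simp only at h
    rw [h]
  have hsum : ∑ q ∈ P, (q : ℝ)⁻¹ ≤ (n : ℝ)⁻¹ * ∑ k ∈ Icc (1 : ℕ) (2 * n ^ 3), (k : ℝ)⁻¹ := by
    calc ∑ q ∈ P, (q : ℝ)⁻¹ ≤ ∑ q ∈ P, (n : ℝ)⁻¹ * (((q - 1) / n : ℕ) : ℝ)⁻¹ := by
          refine sum_le_sum fun q hq => ?_
          have h := hform q hq
          have hpos : 0 < (q - 1) / n := by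
            simp only [hP, mem_filter, mem_Icc] at hq
            rcases Nat.eq_zero_or_pos ((q - 1) / n) with h0 | h0
            · rw [h0] at h; omega
            · exact h0
          rw [← mul_inv]
          refine inv_anti₀ (by positivity) ?_
          exact_mod_cast (show n * ((q - 1) / n) ≤ q by omega)
      _ = (n : ℝ)⁻¹ * ∑ k ∈ P.image (fun q => (q - 1) / n), (k : ℝ)⁻¹ := by
          rw [sum_image hinj, mul_sum]
      _ ≤ _ := by
          refine mul_le_mul_of_nonneg_left ?_ (by positivity)
          refine sum_le_sum_of_subset_of_nonneg ?_ fun _ _ _ => by positivity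
          intro k hk
          obtain ⟨q, hq, rfl⟩ := mem_image.1 hk
          have h := hform q hq
          simp only [hP, mem_filter, mem_Icc] at hq
          rw [mem_Icc]
          constructor
          · rcases Nat.eq_zero_or_pos ((q - 1) / n) with h0 | h0
            · rw [h0] at h; omega
            · exact h0
          · refine Nat.le_of_mul_le_mul_left ?_ hn
            calc n * ((q - 1) / n) ≤ q := by omega
              _ ≤ 2 * n ^ 4 := hq.1.2
              _ = n * (2 * n ^ 3) := by ring
  have hh := harmonic_le_one_add_log (2 * n ^ 3)
  rw [harmonic_eq_sum_Icc] at hh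
  push_cast at hh
  rw [Real.log_mul (by norm_num) (by positivity), Real.log_pow] at hh
  push_cast at hh
  have ht : (n.totient : ℝ) ≤ n := by exact_mod_cast Nat.totient_le n
  have hlog2 := Real.log_two_lt_d9
  have hlogn := Real.log_nonneg hn1
  calc n.totient * ∑ q ∈ P, (q : ℝ)⁻¹ ≤ n * ((n : ℝ)⁻¹ * ∑ k ∈ Icc (1 : ℕ) (2 * n ^ 3), (k : ℝ)⁻¹) :=
        mul_le_mul ht hsum (sum_nonneg fun _ _ => by positivity) hn0.le
    _ = ∑ k ∈ Icc (1 : ℕ) (2 * n ^ 3), (k : ℝ)⁻¹ := by field_simp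
    _ ≤ _ := by linarith

/-- For q = p^f with f ≥ 2, put r = p^⌊f/2⌋. Then r² ≤ q ≤ r³, so q > n³ forces r > n, and q is
determined by r and the parity of f. The sum is at most 2 ∑ 1/r² over r > n, that is 2/n, without
any congruence condition. -/
theorem totient_mul_sum_proper_primePow_le {n : ℕ} (hn : 1 ≤ n) (M : ℕ) :
    n.totient * ∑ q ∈ Ioc (2 * n ^ 4) M with IsPrimePow q ∧ ¬ q.Prime, (q : ℝ)⁻¹ ≤ 2 := by
  have hn0 : (0 : ℝ) < n := by positivity
  set P := (Ioc (2 * n ^ 4) M).filter fun q => IsPrimePow q ∧ ¬ q.Prime with hP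
  have hex : ∀ q ∈ P, ∃ p f : ℕ, p.Prime ∧ 2 ≤ f ∧ p ^ f = q := by
    intro q hq
    obtain ⟨p, f, hp, hf, rfl⟩ := (isPrimePow_nat_iff q).1 (mem_filter.1 hq).2.1
    refine ⟨p, f, hp, ?_, rfl⟩
    by_contra h
    obtain rfl : f = 1 := by omega
    exact (mem_filter.1 hq).2.2 (by simpa using hp)
  choose! p f hp hf hpf using hex
  -- The prime p is the least prime factor of p^⌊f/2⌋, since ⌊f/2⌋ ≥ 1.
  have hrec : ∀ q ∈ P, (p q ^ (f q / 2)) ^ 2 * (p q ^ (f q / 2)).minFac ^ (f q % 2) = q := by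
    intro q hq
    have := hf q hq
    rw [(hp q hq).pow_minFac (by omega), ← pow_mul, ← pow_add]
    rw [Nat.div_add_mod' (f q) 2, hpf q hq]
  have hinj : Set.InjOn (fun q => (p q ^ (f q / 2), f q % 2)) P := by
    intro a ha b hb h
    simp only [Prod.mk.injEq] at h
    rw [← hrec a ha, ← hrec b hb, h.1, h.2]
  have hgt : ∀ q ∈ P, n < p q ^ (f q / 2) := by
    intro q hq
    have h2 := hf q hq
    have h1 : q ≤ (p q ^ (f q / 2)) ^ 3 := by
      rw [← pow_mul]
      nth_rewrite 1 [← hpf q hq]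
      exact Nat.pow_le_pow_right (hp q hq).pos (by omega)
    have h3 : n ^ 3 < (p q ^ (f q / 2)) ^ 3 := by
      refine lt_of_lt_of_le ?_ h1
      simp only [hP, mem_filter, mem_Ioc] at hq
      have : n ^ 3 ≤ n ^ 4 := Nat.pow_le_pow_right hn (by norm_num)
      omega
    exact lt_of_pow_lt_pow_left₀ 3 (Nat.zero_le _) h3
  have hle : ∀ q ∈ P, (p q ^ (f q / 2)) ^ 2 ≤ q := by
    intro q hq
    rw [← pow_mul]
    nth_rewrite 3 [← hpf q hq]
    exact Nat.pow_le_pow_right (hp q hq).pos (by omega)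
  have hsum : ∑ q ∈ P, (q : ℝ)⁻¹ ≤ 2 * (n : ℝ)⁻¹ := by
    calc ∑ q ∈ P, (q : ℝ)⁻¹ ≤ ∑ q ∈ P, (((p q ^ (f q / 2) : ℕ) : ℝ) ^ 2)⁻¹ := by
          refine sum_le_sum fun q hq => ?_
          have h := hle q hq
          have h' : 0 < p q ^ (f q / 2) := pow_pos (hp q hq).pos _
          refine inv_anti₀ (by positivity) ?_
          exact_mod_cast h
      _ = ∑ r ∈ P.image (fun q => (p q ^ (f q / 2), f q % 2)), ((r.1 : ℝ) ^ 2)⁻¹ :=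
          (sum_image (f := fun r : ℕ × ℕ => ((r.1 : ℝ) ^ 2)⁻¹) hinj).symm
      _ ≤ ∑ r ∈ Ioc n (n + M) ×ˢ range 2, ((r.1 : ℝ) ^ 2)⁻¹ := by
          refine sum_le_sum_of_subset_of_nonneg ?_ fun _ _ _ => by positivity
          intro r hr
          obtain ⟨q, hq, rfl⟩ := mem_image.1 hr
          simp only [mem_product, mem_Ioc, mem_range]
          refine ⟨⟨hgt q hq, ?_⟩, Nat.mod_lt _ (by norm_num)⟩
          have h := hle q hq
          have h' := Nat.le_self_pow (two_ne_zero) (p q ^ (f q / 2))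
          simp only [hP, mem_filter, mem_Ioc] at hq
          omega
      _ = 2 * ∑ e ∈ Ioc n (n + M), ((e : ℝ) ^ 2)⁻¹ := by
          rw [sum_product, mul_sum]
          refine sum_congr rfl fun e _ => ?_
          simp [two_mul]
      _ ≤ 2 * (n : ℝ)⁻¹ := by
          have h := sum_Ioc_inv_sq_le_sub (α := ℝ) (k := n) (n := n + M) (by omega) (by omega)
          have : (0 : ℝ) ≤ ((n + M : ℕ) : ℝ)⁻¹ := by positivity
          linarith
  have ht : (n.totient : ℝ) ≤ n := by exact_mod_cast Nat.totient_le n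
  calc _ ≤ n * (2 * (n : ℝ)⁻¹) :=
        mul_le_mul ht hsum (sum_nonneg fun _ _ => by positivity) hn0.le
    _ = 2 := by field_simp

theorem totient_mul_sum_primePow_modEq_one_le {n : ℕ} (hn : 1 ≤ n) (J : ℕ) :
    n.totient * ∑ q ∈ Icc 2 (2 ^ J) with IsPrimePow q ∧ q ≡ 1 [MOD n], (q : ℝ)⁻¹ ≤
      4 + 3 * Real.log n + 104 * ∑ j ∈ Icc 1 J, (j : ℝ)⁻¹ := by
  have h1 := totient_mul_sum_modEq_one_small_le hn
  have h2 := totient_mul_sum_proper_primePow_le hn (2 ^ J)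
  have h3 := totient_mul_sum_primes_modEq_one_le hn J
  have hsub : (Icc 2 (2 ^ J)).filter (fun q => IsPrimePow q ∧ q ≡ 1 [MOD n]) ⊆
      ((Icc 2 (2 * n ^ 4)).filter fun q => q ≡ 1 [MOD n]) ∪
      (((Ioc (2 * n ^ 4) (2 ^ J)).filter fun q => IsPrimePow q ∧ ¬ q.Prime) ∪
      (Ioc (2 * n ^ 4) (2 ^ J)).filter fun p => p.Prime ∧ p ≡ 1 [MOD n]) := by
    intro q hq
    simp only [mem_filter, mem_Icc, mem_union, mem_Ioc] at hq ⊢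
    by_cases hs : q ≤ 2 * n ^ 4
    · exact Or.inl ⟨⟨hq.1.1, hs⟩, hq.2.2⟩
    · by_cases hp : q.Prime
      · exact Or.inr (Or.inr ⟨⟨by omega, hq.1.2⟩, hp, hq.2.2⟩)
      · exact Or.inr (Or.inl ⟨⟨by omega, hq.1.2⟩, hq.2.1, hp⟩)
  have hnn : ∀ s : Finset ℕ, 0 ≤ ∑ q ∈ s, (q : ℝ)⁻¹ := fun s => sum_nonneg fun _ _ => by positivity
  have hu : ∀ s t : Finset ℕ, ∑ q ∈ s ∪ t, (q : ℝ)⁻¹ ≤ ∑ q ∈ s, (q : ℝ)⁻¹ + ∑ q ∈ t, (q : ℝ)⁻¹ := by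
    intro s t
    rw [← sum_union_inter]
    linarith [hnn (s ∩ t)]
  have hS := (sum_le_sum_of_subset_of_nonneg hsub
    fun (q : ℕ) _ _ => (by positivity : (0 : ℝ) ≤ (q : ℝ)⁻¹)).trans
    ((hu _ _).trans (add_le_add_right (hu _ _) _))
  have := mul_le_mul_of_nonneg_left hS (Nat.cast_nonneg (α := ℝ) n.totient)
  rw [mul_add, mul_add] at this
  linarith

/-! ### Prime ideals, their norms and the rational primes below them. -/

section PrimeIdeals

variable {K : Type*} [Field K] [NumberField K]

theorem finite_setOf_absNorm_asIdeal_le (x : ℝ) :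
    {𝔭 : HeightOneSpectrum (𝓞 K) | (Ideal.absNorm 𝔭.asIdeal : ℝ) ≤ x}.Finite := by
  refine Set.Finite.of_finite_image (f := HeightOneSpectrum.asIdeal)
    ((Ideal.finite_setOfPred_absNorm_le (S := 𝓞 K) ⌊x⌋₊).subset ?_)
    fun 𝔭 _ 𝔮 _ h => HeightOneSpectrum.ext h
  rintro _ ⟨𝔭, h, rfl⟩
  exact Nat.le_floor h

variable (K) in
/-- The finite set of nonzero prime ideals of norm at most `x`. -/
noncomputable def primesOfNormLE (x : ℝ) : Finset (HeightOneSpectrum (𝓞 K)) :=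
  (finite_setOf_absNorm_asIdeal_le x).toFinset

theorem mem_primesOfNormLE {x : ℝ} {𝔭 : HeightOneSpectrum (𝓞 K)} :
    𝔭 ∈ primesOfNormLE K x ↔ (Ideal.absNorm 𝔭.asIdeal : ℝ) ≤ x := by
  simp [primesOfNormLE]

/-- The rational prime below a prime ideal. -/
noncomputable def residueChar (𝔭 : HeightOneSpectrum (𝓞 K)) : ℕ :=
  Ideal.absNorm (Ideal.under ℤ 𝔭.asIdeal)

theorem residueChar_prime (𝔭 : HeightOneSpectrum (𝓞 K)) : (residueChar 𝔭).Prime := by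
  have : NeZero 𝔭.asIdeal := ⟨𝔭.ne_bot⟩
  exact Nat.absNorm_under_prime 𝔭.asIdeal

theorem liesOver_residueChar (𝔭 : HeightOneSpectrum (𝓞 K)) :
    𝔭.asIdeal.LiesOver (Ideal.span {(residueChar 𝔭 : ℤ)}) := by
  refine ⟨?_⟩
  rw [residueChar, Int.ideal_span_absNorm_eq_self]

theorem absNorm_eq_residueChar_pow (𝔭 : HeightOneSpectrum (𝓞 K)) :
    Ideal.absNorm 𝔭.asIdeal = residueChar 𝔭 ^ 𝔭.asIdeal.inertiaDeg ℤ := by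
  have := liesOver_residueChar 𝔭
  exact (Ideal.pow_inertiaDeg (residueChar 𝔭) 𝔭.asIdeal).symm

theorem isPrimePow_absNorm (𝔭 : HeightOneSpectrum (𝓞 K)) :
    IsPrimePow (Ideal.absNorm 𝔭.asIdeal) := by
  have := liesOver_residueChar 𝔭
  rw [absNorm_eq_residueChar_pow]
  exact (residueChar_prime 𝔭).isPrimePow.pow (Ideal.inertiaDeg_pos 𝔭.asIdeal ℤ).ne'

theorem two_le_absNorm (𝔭 : HeightOneSpectrum (𝓞 K)) : 2 ≤ Ideal.absNorm 𝔭.asIdeal :=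
  (isPrimePow_absNorm 𝔭).two_le

theorem residueChar_eq_of_absNorm_eq {𝔭 𝔮 : HeightOneSpectrum (𝓞 K)}
    (h : Ideal.absNorm 𝔭.asIdeal = Ideal.absNorm 𝔮.asIdeal) : residueChar 𝔭 = residueChar 𝔮 := by
  have h1 := (Ideal.inertiaDeg_pos 𝔭.asIdeal ℤ).ne'
  have h2 := (Ideal.inertiaDeg_pos 𝔮.asIdeal ℤ).ne'
  rw [absNorm_eq_residueChar_pow, absNorm_eq_residueChar_pow] at h
  rw [← (residueChar_prime 𝔭).pow_minFac h1, h, (residueChar_prime 𝔮).pow_minFac h2]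

theorem card_filter_residueChar_le (s : Finset (HeightOneSpectrum (𝓞 K))) (p : ℕ) [Fact p.Prime] :
    #{𝔭 ∈ s | residueChar 𝔭 = p} ≤ ((Ideal.span {(p : ℤ)}).primesOver (𝓞 K)).ncard := by
  have hp : (Ideal.span {(p : ℤ)}).IsPrime :=
    (Ideal.span_singleton_prime (by exact_mod_cast (Fact.out : p.Prime).ne_zero)).2
      (Nat.prime_iff_prime_int.1 Fact.out)
  have hfin : ((Ideal.span {(p : ℤ)}).primesOver (𝓞 K)).Finite :=
    Algebra.QuasiFinite.finite_primesOver _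
  rw [← Set.ncard_coe_finset]
  refine Set.ncard_le_ncard_of_injOn HeightOneSpectrum.asIdeal ?_
    (fun 𝔭 _ 𝔮 _ h => HeightOneSpectrum.ext h) hfin
  intro 𝔭 h𝔭
  simp only [coe_filter, Set.mem_ofPred_eq] at h𝔭
  have := liesOver_residueChar 𝔭
  rw [h𝔭.2] at this
  exact ⟨𝔭.isPrime, this⟩

end PrimeIdeals

/-! ### The sum of 1/N(𝔭) in a cyclotomic field. -/

section Cyclotomic

variable {K : Type*} [Field K] [NumberField K]

theorem totient_eq_ncard_primesOver_mul (n : ℕ) [NeZero n] [IsCyclotomicExtension {n} ℚ K]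
    (p : ℕ) [hp : Fact p.Prime] :
    ((Ideal.span {(p : ℤ)}).primesOver (𝓞 K)).ncard *
      ((Ideal.span {(p : ℤ)}).ramificationIdxIn (𝓞 K) *
        (Ideal.span {(p : ℤ)}).inertiaDegIn (𝓞 K)) = n.totient := by
  have : IsGalois ℚ K := IsCyclotomicExtension.isGalois {n} ℚ K
  have hp' : (Ideal.span {(p : ℤ)}).IsPrime :=
    (Ideal.span_singleton_prime (by exact_mod_cast hp.out.ne_zero)).2
      (Nat.prime_iff_prime_int.1 hp.out)
  rw [Ideal.ncard_primesOver_mul_ramificationIdxIn_mul_inertiaDegIn _ (𝓞 K) Gal(K/ℚ),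
    IsGalois.card_aut_eq_finrank,
    IsCyclotomicExtension.finrank K (Polynomial.cyclotomic.irreducible_rat (NeZero.pos n))]

theorem pow_orderOf_natCast_modEq_one (m p : ℕ) : p ^ orderOf (p : ZMod m) ≡ 1 [MOD m] := by
  rw [← ZMod.natCast_eq_natCast_iff]
  push_cast
  exact pow_orderOf_eq_one _

/-- The inertia degree of an unramified p is its order modulo n. -/
theorem absNorm_modEq_one (n : ℕ) [NeZero n] [IsCyclotomicExtension {n} ℚ K]
    (𝔭 : HeightOneSpectrum (𝓞 K)) (h : ¬ residueChar 𝔭 ∣ n) :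
    Ideal.absNorm 𝔭.asIdeal ≡ 1 [MOD n] := by
  have := liesOver_residueChar 𝔭
  have : Fact (residueChar 𝔭).Prime := ⟨residueChar_prime 𝔭⟩
  rw [absNorm_eq_residueChar_pow,
    IsCyclotomicExtension.Rat.inertiaDeg_eq_of_not_dvd (residueChar 𝔭) K 𝔭.asIdeal h]
  exact pow_orderOf_natCast_modEq_one _ _

theorem ncard_primesOver_le_totient (n : ℕ) [NeZero n] [IsCyclotomicExtension {n} ℚ K]
    (p : ℕ) [hp : Fact p.Prime] :
    ((Ideal.span {(p : ℤ)}).primesOver (𝓞 K)).ncard ≤ n.totient := by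
  have h := totient_eq_ncard_primesOver_mul (K := K) n p
  exact Nat.le_of_dvd (Nat.totient_pos.2 (NeZero.pos n)) ⟨_, h.symm⟩

/-- Write n = p^(k+1) m with p ∤ m. The ramification index is φ(p^(k+1)), so the number g of primes
above p divides φ(m). The norm is p to its order modulo m, so m divides N(𝔭) - 1 > 0. Hence g ≤ φ(m)
≤ m ≤ N(𝔭), and all primes above p together contribute at most 1 to ∑ 1/N(𝔭). -/
theorem ncard_primesOver_le_absNorm (n : ℕ) [NeZero n] [IsCyclotomicExtension {n} ℚ K]
    (𝔭 : HeightOneSpectrum (𝓞 K)) (h : residueChar 𝔭 ∣ n) :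
    ((Ideal.span {(residueChar 𝔭 : ℤ)}).primesOver (𝓞 K)).ncard ≤ Ideal.absNorm 𝔭.asIdeal := by
  have := liesOver_residueChar 𝔭
  have hp := residueChar_prime 𝔭
  have : Fact (residueChar 𝔭).Prime := ⟨hp⟩
  obtain ⟨k, m, hm, hn⟩ := Nat.exists_eq_pow_mul_and_not_dvd (NeZero.ne n) (residueChar 𝔭) hp.ne_one
  obtain ⟨k, rfl⟩ : ∃ l, k = l + 1 := Nat.exists_eq_succ_of_ne_zero (by
    rintro rfl
    rw [pow_zero, one_mul] at hn
    exact hm (hn ▸ h))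
  have hN2 := two_le_absNorm 𝔭
  have hmod : Ideal.absNorm 𝔭.asIdeal ≡ 1 [MOD m] := by
    rw [absNorm_eq_residueChar_pow, IsCyclotomicExtension.Rat.inertiaDeg_eq n K 𝔭.asIdeal hn hm]
    exact pow_orderOf_natCast_modEq_one _ _
  have hmN : m ≤ Ideal.absNorm 𝔭.asIdeal := by
    have h1 := (Nat.modEq_iff_dvd' (by omega)).1 hmod.symm
    have := Nat.le_of_dvd (by omega) h1
    omega
  have htot := totient_eq_ncard_primesOver_mul (K := K) n (residueChar 𝔭)
  rw [IsCyclotomicExtension.Rat.ramificationIdxIn_eq n K hn hm] at htot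
  have hco : (residueChar 𝔭 ^ (k + 1)).Coprime m :=
    Nat.Coprime.pow_left _ ((Nat.Prime.coprime_iff_not_dvd hp).2 hm)
  have hφ : n.totient = residueChar 𝔭 ^ k * (residueChar 𝔭 - 1) * m.totient := by
    conv_lhs => rw [hn]
    rw [Nat.totient_mul hco, Nat.totient_prime_pow_succ hp]
  have hpos : 0 < residueChar 𝔭 ^ k * (residueChar 𝔭 - 1) :=
    Nat.mul_pos (pow_pos hp.pos _) (Nat.sub_pos_of_lt hp.one_lt)
  have hm0 : 0 < m := Nat.pos_of_ne_zero fun h0 => hm (h0 ▸ dvd_zero _)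
  have hdvd : ((Ideal.span {(residueChar 𝔭 : ℤ)}).primesOver (𝓞 K)).ncard ∣ m.totient := by
    refine ⟨(Ideal.span {(residueChar 𝔭 : ℤ)}).inertiaDegIn (𝓞 K), ?_⟩
    refine Nat.eq_of_mul_eq_mul_left hpos ?_
    rw [← hφ, ← htot]
    ring
  exact (Nat.le_of_dvd (Nat.totient_pos.2 hm0) hdvd).trans ((Nat.totient_le m).trans hmN)

theorem card_primeFactors_le_two_mul_log {n : ℕ} (hn : n ≠ 0) :
    (#n.primeFactors : ℝ) ≤ 2 * Real.log n := by
  have h1 : 2 ^ #n.primeFactors ≤ n := by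
    refine (pow_card_le_prod _ _ _ fun p hp => (Nat.prime_of_mem_primeFactors hp).two_le).trans ?_
    exact Nat.le_of_dvd (Nat.pos_of_ne_zero hn) (Nat.prod_primeFactors_dvd n)
  have h2 : ((2 : ℝ) ^ #n.primeFactors) ≤ n := by exact_mod_cast h1
  have h3 := Real.log_le_log (by positivity) h2
  rw [Real.log_pow] at h3
  have h4 : (1 / 2 : ℝ) ≤ Real.log 2 := by linarith [Real.log_two_gt_d9]
  nlinarith [Nat.cast_nonneg (α := ℝ) #n.primeFactors]

theorem sum_ramified_inv_absNorm_le (n : ℕ) [NeZero n] [IsCyclotomicExtension {n} ℚ K]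
    (s : Finset (HeightOneSpectrum (𝓞 K))) :
    ∑ 𝔭 ∈ s with residueChar 𝔭 ∣ n, (Ideal.absNorm 𝔭.asIdeal : ℝ)⁻¹ ≤ 2 * Real.log n := by
  refine le_trans ?_ (card_primeFactors_le_two_mul_log (NeZero.ne n))
  have hmaps : ∀ 𝔭 ∈ s.filter (fun 𝔭 => residueChar 𝔭 ∣ n), residueChar 𝔭 ∈ n.primeFactors :=
    fun 𝔭 h => Nat.mem_primeFactors.2 ⟨residueChar_prime 𝔭, (mem_filter.1 h).2, NeZero.ne n⟩
  rw [← sum_fiberwise_of_maps_to hmaps, card_eq_sum_ones, Nat.cast_sum]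
  refine sum_le_sum fun p hp => ?_
  have : Fact p.Prime := ⟨Nat.prime_of_mem_primeFactors hp⟩
  set g := ((Ideal.span {(p : ℤ)}).primesOver (𝓞 K)).ncard with hg
  rcases Nat.eq_zero_or_pos g with h0 | h0
  · have := card_filter_residueChar_le (s.filter (fun 𝔭 => residueChar 𝔭 ∣ n)) p
    rw [← hg, h0, Nat.le_zero, card_eq_zero] at this
    rw [this]; simp
  calc _ ≤ #{𝔭 ∈ s.filter (fun 𝔭 => residueChar 𝔭 ∣ n) | residueChar 𝔭 = p} • (g : ℝ)⁻¹ := by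
        refine sum_le_card_nsmul _ _ _ fun 𝔭 h𝔭 => ?_
        simp only [mem_filter] at h𝔭
        refine inv_anti₀ (by positivity) ?_
        have := ncard_primesOver_le_absNorm n 𝔭 h𝔭.1.2
        rw [h𝔭.2] at this
        exact_mod_cast this
    _ ≤ g * (g : ℝ)⁻¹ := by
        rw [nsmul_eq_mul]
        refine mul_le_mul_of_nonneg_right ?_ (by positivity)
        exact_mod_cast card_filter_residueChar_le _ p
    _ = ((1 : ℕ) : ℝ) := by
        rw [Nat.cast_one]
        exact mul_inv_cancel₀ (by positivity)

/-- Grouping by norm q: all primes of norm q lie above the same rational prime, so there are at most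
φ(n) of them. -/
theorem sum_unramified_inv_absNorm_le (n : ℕ) [NeZero n] [IsCyclotomicExtension {n} ℚ K]
    {x : ℝ} {J : ℕ} (hx : x ≤ 2 ^ J) :
    ∑ 𝔭 ∈ primesOfNormLE K x with ¬ residueChar 𝔭 ∣ n, (Ideal.absNorm 𝔭.asIdeal : ℝ)⁻¹ ≤
      n.totient * ∑ q ∈ Icc 2 (2 ^ J) with IsPrimePow q ∧ q ≡ 1 [MOD n], (q : ℝ)⁻¹ := by
  have hmaps : ∀ 𝔭 ∈ (primesOfNormLE K x).filter (fun 𝔭 => ¬ residueChar 𝔭 ∣ n),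
      Ideal.absNorm 𝔭.asIdeal ∈
        (Icc 2 (2 ^ J)).filter fun q => IsPrimePow q ∧ q ≡ 1 [MOD n] := by
    intro 𝔭 h
    simp only [mem_filter, mem_primesOfNormLE, mem_Icc] at h ⊢
    refine ⟨⟨two_le_absNorm 𝔭, ?_⟩, isPrimePow_absNorm 𝔭, absNorm_modEq_one n 𝔭 h.2⟩
    exact_mod_cast h.1.trans hx
  rw [← sum_fiberwise_of_maps_to hmaps, mul_sum]
  refine sum_le_sum fun q _ => ?_
  rw [sum_congr rfl fun 𝔭 h𝔭 => by rw [(mem_filter.1 h𝔭).2], sum_const, nsmul_eq_mul]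
  refine mul_le_mul_of_nonneg_right ?_ (by positivity)
  refine Nat.cast_le.2 ?_
  set t := ((primesOfNormLE K x).filter (fun 𝔭 => ¬ residueChar 𝔭 ∣ n)).filter
    (fun 𝔭 => Ideal.absNorm 𝔭.asIdeal = q) with ht
  rcases t.eq_empty_or_nonempty with he | ⟨𝔮, h𝔮⟩
  · rw [he]; simp
  have : Fact (residueChar 𝔮).Prime := ⟨residueChar_prime 𝔮⟩
  have hsub : t ⊆ t.filter fun 𝔭 => residueChar 𝔭 = residueChar 𝔮 := by
    intro 𝔭 h𝔭
    refine mem_filter.2 ⟨h𝔭, residueChar_eq_of_absNorm_eq ?_⟩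
    rw [(mem_filter.1 h𝔭).2, (mem_filter.1 h𝔮).2]
  exact (card_le_card hsub).trans
    ((card_filter_residueChar_le t _).trans (ncard_primesOver_le_totient n _))

/-- An upper bound of Mertens type for the prime ideals of a cyclotomic field. -/
theorem sum_inv_absNorm_cyclotomic_le (n : ℕ) [NeZero n] [IsCyclotomicExtension {n} ℚ K]
    {x : ℝ} (hx : 3 ≤ x) :
    ∑ 𝔭 ∈ primesOfNormLE K x, (Ideal.absNorm 𝔭.asIdeal : ℝ)⁻¹ ≤
      5 * Real.log n + 104 * Real.log (Real.log x) + 350 := by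
  have hlx : 1 < Real.log x := by
    rw [Real.lt_log_iff_exp_lt (by linarith)]
    linarith [Real.exp_one_lt_d9]
  -- Chosen so that 2^J ≥ x, by log 2 ≥ 1/2, while the harmonic sum up to J is log log x + O(1).
  set J := ⌈2 * Real.log x⌉₊ with hJ
  have hJ1 : 2 * Real.log x ≤ J := Nat.le_ceil _
  have hJ2 : (J : ℝ) ≤ 3 * Real.log x := by
    have := Nat.ceil_lt_add_one (show 0 ≤ 2 * Real.log x by linarith)
    linarith
  have hxJ : x ≤ 2 ^ J := by
    rw [← Real.log_le_log_iff (by linarith) (by positivity), Real.log_pow]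
    have : (1 / 2 : ℝ) ≤ Real.log 2 := by linarith [Real.log_two_gt_d9]
    nlinarith
  have h1 := sum_ramified_inv_absNorm_le n (primesOfNormLE K x)
  have h2 := sum_unramified_inv_absNorm_le (K := K) n hxJ
  have h3 := totient_mul_sum_primePow_modEq_one_le (NeZero.pos n) J
  have h4 := harmonic_le_one_add_log J
  rw [harmonic_eq_sum_Icc] at h4
  push_cast at h4
  have h5 : Real.log J ≤ Real.log 3 + Real.log (Real.log x) := by
    rw [← Real.log_mul (by norm_num) (by linarith)]
    exact Real.log_le_log (by linarith) hJ2
  have h6 : Real.log 3 ≤ 2 := by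
    have := Real.log_le_sub_one_of_pos (show (0 : ℝ) < 3 by norm_num)
    linarith
  rw [← sum_filter_add_sum_filter_not _ (fun 𝔭 => residueChar 𝔭 ∣ n)]
  linarith

end Cyclotomic

/-! ### Euler products over finitely many primes and Rankin's trick. -/

section EulerProduct

variable {K : Type*} [Field K] [NumberField K]

/-- The nonzero ideals all of whose prime divisors lie in `B`. -/
def supportedIdeals (B : Finset (HeightOneSpectrum (𝓞 K))) : Set (Ideal (𝓞 K)) :=
  {𝔞 | 𝔞 ≠ ⊥ ∧ ∀ 𝔭 : HeightOneSpectrum (𝓞 K), 𝔭.asIdeal ∣ 𝔞 → 𝔭 ∈ B}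

theorem asIdeal_dvd_iff_of_prime {𝔭 𝔮 : HeightOneSpectrum (𝓞 K)} :
    𝔭.asIdeal ∣ 𝔮.asIdeal ↔ 𝔭 = 𝔮 := by
  refine ⟨fun h => ?_, fun h => h ▸ dvd_rfl⟩
  exact HeightOneSpectrum.ext
    (associated_iff_eq.1 ((𝔭.prime.dvd_prime_iff_associated 𝔮.prime).1 h))

theorem asIdeal_dvd_pow_mul {𝔭 𝔮 : HeightOneSpectrum (𝓞 K)} {k : ℕ} {𝔟 : Ideal (𝓞 K)}
    (h : 𝔮.asIdeal ∣ 𝔭.asIdeal ^ k * 𝔟) : 𝔮 = 𝔭 ∨ 𝔮.asIdeal ∣ 𝔟 := by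
  rcases 𝔮.prime.dvd_or_dvd h with h | h
  · exact Or.inl (asIdeal_dvd_iff_of_prime.1 (𝔮.prime.dvd_of_dvd_pow h))
  · exact Or.inr h

theorem exists_eq_asIdeal_pow_mul (𝔭 : HeightOneSpectrum (𝓞 K)) {𝔞 : Ideal (𝓞 K)} (h : 𝔞 ≠ ⊥) :
    ∃ k 𝔟, 𝔞 = 𝔭.asIdeal ^ k * 𝔟 ∧ ¬ 𝔭.asIdeal ∣ 𝔟 ∧ 𝔟 ≠ ⊥ := by
  have hfin : FiniteMultiplicity 𝔭.asIdeal 𝔞 :=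
    FiniteMultiplicity.of_prime_left 𝔭.prime h
  obtain ⟨𝔟, h1, h2⟩ := hfin.exists_eq_pow_mul_and_not_dvd
  refine ⟨_, 𝔟, h1, h2, ?_⟩
  rintro rfl
  exact h2 (dvd_zero _)

theorem eq_of_pow_mul_eq_pow_mul {𝔭 : HeightOneSpectrum (𝓞 K)} {k l : ℕ} {𝔟 𝔠 : Ideal (𝓞 K)}
    (hb : ¬ 𝔭.asIdeal ∣ 𝔟) (hc : ¬ 𝔭.asIdeal ∣ 𝔠)
    (h : 𝔭.asIdeal ^ k * 𝔟 = 𝔭.asIdeal ^ l * 𝔠) : k = l ∧ 𝔟 = 𝔠 := by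
  have hp : 𝔭.asIdeal ≠ 0 := 𝔭.prime.ne_zero
  wlog hkl : k ≤ l generalizing k l 𝔟 𝔠
  · obtain ⟨h1, h2⟩ := this hc hb h.symm (by omega)
    exact ⟨h1.symm, h2.symm⟩
  obtain ⟨d, rfl⟩ := Nat.exists_eq_add_of_le hkl
  rw [pow_add, mul_assoc] at h
  have h' := mul_left_cancel₀ (pow_ne_zero k hp) h
  rcases Nat.eq_zero_or_pos d with rfl | hd
  · exact ⟨rfl, by simpa using h'⟩
  · exact absurd (h' ▸ (dvd_pow_self _ hd.ne').mul_right _) hb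

theorem pow_mul_mem_supportedIdeals {𝔭 : HeightOneSpectrum (𝓞 K)}
    {B : Finset (HeightOneSpectrum (𝓞 K))} [DecidableEq (HeightOneSpectrum (𝓞 K))] (k : ℕ)
    {𝔟 : Ideal (𝓞 K)} (h : 𝔟 ∈ supportedIdeals B) :
    𝔭.asIdeal ^ k * 𝔟 ∈ supportedIdeals (insert 𝔭 B) := by
  refine ⟨mul_ne_zero (pow_ne_zero _ 𝔭.prime.ne_zero) h.1, fun 𝔮 hq => ?_⟩
  rcases asIdeal_dvd_pow_mul hq with rfl | hq
  · exact mem_insert_self _ _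
  · exact mem_insert_of_mem (h.2 𝔮 hq)

theorem mem_supportedIdeals_of_pow_mul {𝔭 : HeightOneSpectrum (𝓞 K)}
    {B : Finset (HeightOneSpectrum (𝓞 K))} [DecidableEq (HeightOneSpectrum (𝓞 K))] {k : ℕ}
    {𝔟 : Ideal (𝓞 K)} (hb : ¬ 𝔭.asIdeal ∣ 𝔟)
    (h : 𝔭.asIdeal ^ k * 𝔟 ∈ supportedIdeals (insert 𝔭 B)) : 𝔟 ∈ supportedIdeals B := by
  refine ⟨right_ne_zero_of_mul h.1, fun 𝔮 hq => ?_⟩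
  refine mem_of_mem_insert_of_ne (h.2 𝔮 (hq.mul_left _)) ?_
  rintro rfl
  exact hb hq

/-- The decomposition `(k, 𝔟) ↦ 𝔭 ^ k * 𝔟`. -/
noncomputable def supportedIdealsInsertEquiv [DecidableEq (HeightOneSpectrum (𝓞 K))]
    {𝔭 : HeightOneSpectrum (𝓞 K)} {B : Finset (HeightOneSpectrum (𝓞 K))} (h : 𝔭 ∉ B) :
    ℕ × supportedIdeals B ≃ supportedIdeals (insert 𝔭 B) :=
  Equiv.ofBijective
    (fun q => ⟨𝔭.asIdeal ^ q.1 * q.2, pow_mul_mem_supportedIdeals q.1 q.2.2⟩) <| by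
    constructor
    · rintro ⟨k, 𝔟, hb⟩ ⟨l, 𝔠, hc⟩ heq
      obtain ⟨h1, h2⟩ := eq_of_pow_mul_eq_pow_mul (fun hd => h (hb.2 _ hd)) (fun hd => h (hc.2 _ hd))
        (congrArg Subtype.val heq)
      exact Prod.ext h1 (Subtype.ext h2)
    · rintro ⟨𝔞, ha⟩
      obtain ⟨k, 𝔟, rfl, hb, -⟩ := exists_eq_asIdeal_pow_mul 𝔭 ha.1
      exact ⟨(k, ⟨𝔟, mem_supportedIdeals_of_pow_mul hb ha⟩), rfl⟩

theorem map_pow_of_map_mul {h : Ideal (𝓞 K) → ℝ} (h1 : h ⊤ = 1)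
    (hmul : ∀ 𝔞 𝔟, 𝔞 ≠ ⊥ → 𝔟 ≠ ⊥ → h (𝔞 * 𝔟) = h 𝔞 * h 𝔟) {𝔞 : Ideal (𝓞 K)} (ha : 𝔞 ≠ ⊥)
    (k : ℕ) : h (𝔞 ^ k) = h 𝔞 ^ k := by
  induction k with
  | zero => rw [pow_zero, pow_zero, ← h1, Ideal.one_eq_top]
  | succ k ih => rw [pow_succ, hmul _ _ (pow_ne_zero k ha) ha, ih, pow_succ]

theorem supportedIdeals_empty :
    supportedIdeals (∅ : Finset (HeightOneSpectrum (𝓞 K))) = {⊤} := by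
  ext 𝔞
  constructor
  · rintro ⟨h1, h2⟩
    by_contra hne
    obtain ⟨M, hM, hle⟩ := Ideal.exists_le_maximal 𝔞 hne
    have hMbot : M ≠ ⊥ := by rintro rfl; exact h1 (le_bot_iff.1 hle)
    exact notMem_empty _ (h2 ⟨M, hM.isPrime, hMbot⟩ (Ideal.dvd_iff_le.2 hle))
  · rintro rfl
    refine ⟨top_ne_bot, fun 𝔭 h => ?_⟩
    exact absurd (top_le_iff.1 (Ideal.dvd_iff_le.1 h)) 𝔭.isPrime.ne_top

/-- The Euler product for a completely multiplicative function over the ideals composed of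
finitely many given primes. -/
theorem hasSum_supportedIdeals {h : Ideal (𝓞 K) → ℝ} (h1 : h ⊤ = 1)
    (hmul : ∀ 𝔞 𝔟, 𝔞 ≠ ⊥ → 𝔟 ≠ ⊥ → h (𝔞 * 𝔟) = h 𝔞 * h 𝔟)
    (B : Finset (HeightOneSpectrum (𝓞 K))) (hlt : ∀ 𝔭 ∈ B, |h 𝔭.asIdeal| < 1) :
    HasSum (fun 𝔞 : supportedIdeals B => h 𝔞) (∏ 𝔭 ∈ B, (1 - h 𝔭.asIdeal)⁻¹) := by
  classical
  induction B using Finset.induction_on with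
  | empty =>
    rw [prod_empty, ← h1, supportedIdeals_empty]
    exact hasSum_subtype_iff_indicator.2 (by
      convert hasSum_single (f := ({⊤} : Set (Ideal (𝓞 K))).indicator h) ⊤ fun 𝔞 ha => ?_ using 1
      · simp
      · simp [ha])
  | insert 𝔭 B hB ih =>
    have ih' := ih fun 𝔮 hq => hlt 𝔮 (mem_insert_of_mem hq)
    have hp := hlt 𝔭 (mem_insert_self _ _)
    have hg := hasSum_geometric_of_abs_lt_one hp
    rw [prod_insert hB, ← (supportedIdealsInsertEquiv hB).hasSum_iff]
    refine (hg.mul ih' (summable_mul_of_summable_norm hg.summable.norm ih'.summable.norm)).congr_fun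
      fun q => ?_
    change h (𝔭.asIdeal ^ q.1 * q.2) = h 𝔭.asIdeal ^ q.1 * h q.2
    rw [hmul _ _ (pow_ne_zero _ 𝔭.prime.ne_zero) q.2.2.1,
      map_pow_of_map_mul h1 hmul 𝔭.prime.ne_zero]

theorem mem_idealsOfNormLE {x : ℝ} {𝔞 : Ideal (𝓞 K)} :
    𝔞 ∈ idealsOfNormLE K x ↔ 𝔞 ≠ ⊥ ∧ (Ideal.absNorm 𝔞 : ℝ) ≤ x := by
  simp [idealsOfNormLE]

theorem absNorm_pos_of_ne_bot {𝔞 : Ideal (𝓞 K)} (h : 𝔞 ≠ ⊥) : 0 < Ideal.absNorm 𝔞 :=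
  Nat.pos_of_ne_zero fun h0 => h (Ideal.absNorm_eq_zero_iff.1 h0)

theorem absNorm_le_of_dvd {𝔞 𝔟 : Ideal (𝓞 K)} (h : 𝔟 ≠ ⊥) (hd : 𝔞 ∣ 𝔟) :
    Ideal.absNorm 𝔞 ≤ Ideal.absNorm 𝔟 :=
  Nat.le_of_dvd (absNorm_pos_of_ne_bot h) (map_dvd Ideal.absNorm hd)

theorem mem_supportedIdeals_primesOfNormLE {x : ℝ} {𝔞 : Ideal (𝓞 K)}
    (h : 𝔞 ∈ idealsOfNormLE K x) : 𝔞 ∈ supportedIdeals (primesOfNormLE K x) := by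
  rw [mem_idealsOfNormLE] at h
  refine ⟨h.1, fun 𝔭 hp => mem_primesOfNormLE.2 (le_trans ?_ h.2)⟩
  exact_mod_cast absNorm_le_of_dvd h.1 hp

open Classical in
/-- The ideals of norm at most `x` all of whose prime divisors lie in `B`. -/
noncomputable def supportedIdealsLE (B : Finset (HeightOneSpectrum (𝓞 K))) (x : ℝ) :
    Finset (Ideal (𝓞 K)) :=
  (idealsOfNormLE K x).filter (· ∈ supportedIdeals B)

theorem mem_supportedIdealsLE {B : Finset (HeightOneSpectrum (𝓞 K))} {x : ℝ} {𝔞 : Ideal (𝓞 K)} :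
    𝔞 ∈ supportedIdealsLE B x ↔ 𝔞 ∈ idealsOfNormLE K x ∧ 𝔞 ∈ supportedIdeals B := by
  simp [supportedIdealsLE]

theorem hasSum_indicator_supportedIdeals {h : Ideal (𝓞 K) → ℝ} (h1 : h ⊤ = 1)
    (hmul : ∀ 𝔞 𝔟, 𝔞 ≠ ⊥ → 𝔟 ≠ ⊥ → h (𝔞 * 𝔟) = h 𝔞 * h 𝔟)
    (B : Finset (HeightOneSpectrum (𝓞 K))) (hlt : ∀ 𝔭 ∈ B, |h 𝔭.asIdeal| < 1) :
    HasSum ((supportedIdeals B).indicator h) (∏ 𝔭 ∈ B, (1 - h 𝔭.asIdeal)⁻¹) :=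
  hasSum_subtype_iff_indicator.1 (hasSum_supportedIdeals h1 hmul B hlt)

variable (K) in
/-- The sum `∑ 1 / N(𝔭)` over the prime ideals of norm at most `x`. -/
noncomputable def primeRecipSum (x : ℝ) : ℝ :=
  ∑ 𝔭 ∈ primesOfNormLE K x, (Ideal.absNorm 𝔭.asIdeal : ℝ)⁻¹

theorem primeRecipSum_nonneg (x : ℝ) : 0 ≤ primeRecipSum K x :=
  sum_nonneg fun _ _ => by positivity

theorem primesOfNormLE_mono {x y : ℝ} (h : x ≤ y) : primesOfNormLE K x ⊆ primesOfNormLE K y :=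
  fun _ hp => mem_primesOfNormLE.2 ((mem_primesOfNormLE.1 hp).trans h)

theorem primeRecipSum_mono {x y : ℝ} (h : x ≤ y) : primeRecipSum K x ≤ primeRecipSum K y :=
  sum_le_sum_of_subset_of_nonneg (primesOfNormLE_mono h) fun _ _ _ => by positivity

theorem sum_inv_absNorm_le_exp (x : ℝ) :
    ∑ 𝔞 ∈ idealsOfNormLE K x, (Ideal.absNorm 𝔞 : ℝ)⁻¹ ≤ Real.exp (2 * primeRecipSum K x) := by
  have hN : ∀ 𝔭 : HeightOneSpectrum (𝓞 K), (2 : ℝ) ≤ Ideal.absNorm 𝔭.asIdeal :=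
    fun 𝔭 => by exact_mod_cast two_le_absNorm 𝔭
  have hs := hasSum_indicator_supportedIdeals (h := fun 𝔞 => (Ideal.absNorm 𝔞 : ℝ)⁻¹)
    (by simp) (fun 𝔞 𝔟 _ _ => by simp [mul_comm]) (primesOfNormLE K x) (fun 𝔭 _ => by
      rw [abs_of_nonneg (by positivity)]
      exact inv_lt_one_of_one_lt₀ (by linarith [hN 𝔭]))
  have h1 : ∑ 𝔞 ∈ idealsOfNormLE K x, (Ideal.absNorm 𝔞 : ℝ)⁻¹ =
      ∑ 𝔞 ∈ idealsOfNormLE K x, (supportedIdeals (primesOfNormLE K x)).indicator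
        (fun 𝔞 => (Ideal.absNorm 𝔞 : ℝ)⁻¹) 𝔞 :=
    sum_congr rfl fun 𝔞 ha => by
      rw [Set.indicator_of_mem (mem_supportedIdeals_primesOfNormLE ha)]
  rw [h1]
  refine (sum_le_hasSum _ (fun 𝔞 _ => Set.indicator_nonneg (fun _ _ => by positivity) 𝔞) hs).trans ?_
  rw [primeRecipSum, mul_sum, Real.exp_sum]
  refine prod_le_prod (fun 𝔭 _ => ?_) fun 𝔭 _ => ?_
  · have := hN 𝔭
    rw [inv_nonneg, sub_nonneg]
    exact inv_le_one_of_one_le₀ (by linarith)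
  · have hn := hN 𝔭
    set t : ℝ := (Ideal.absNorm 𝔭.asIdeal : ℝ)⁻¹ with ht
    have ht0 : 0 ≤ t := by positivity
    have ht2 : t ≤ 1 / 2 := by
      rw [ht, one_div]; exact inv_anti₀ (by norm_num) hn
    refine le_trans ?_ (Real.add_one_le_exp _)
    rw [inv_le_iff_one_le_mul₀ (by linarith)]
    nlinarith

/-- The `y`-smooth part of a weighted partial sum with values of absolute value at most one at
the primes is bounded below (Rankin's trick). -/
theorem exp_neg_sub_le_sum_supportedIdeals {g : Ideal (𝓞 K) → ℝ} (g1 : g ⊤ = 1)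
    (gmul : ∀ 𝔞 𝔟, 𝔞 ≠ ⊥ → 𝔟 ≠ ⊥ → g (𝔞 * 𝔟) = g 𝔞 * g 𝔟) {x y σ : ℝ}
    (hg : ∀ 𝔭 ∈ primesOfNormLE K y, |g 𝔭.asIdeal| ≤ 1)
    (hgx : ∀ 𝔞 ∈ supportedIdeals (primesOfNormLE K y), |g 𝔞| ≤ 1)
    (hx : 0 < x) (hσ0 : 0 ≤ σ) (hσ : σ ≤ 1 / 2) (hσy : σ * Real.log y ≤ 1) :
    Real.exp (-primeRecipSum K y) - x ^ (-σ) * Real.exp (12 * primeRecipSum K y) ≤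
      ∑ 𝔞 ∈ supportedIdealsLE (primesOfNormLE K y) x, g 𝔞 / Ideal.absNorm 𝔞 := by
  set B := primesOfNormLE K y with hB
  have hN : ∀ 𝔭 : HeightOneSpectrum (𝓞 K), (2 : ℝ) ≤ Ideal.absNorm 𝔭.asIdeal :=
    fun 𝔭 => by exact_mod_cast two_le_absNorm 𝔭
  have habs : ∀ 𝔭 ∈ B, |g 𝔭.asIdeal / Ideal.absNorm 𝔭.asIdeal| ≤
      (Ideal.absNorm 𝔭.asIdeal : ℝ)⁻¹ := by
    intro 𝔭 hp
    rw [abs_div, Nat.abs_cast, ← one_div]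
    exact div_le_div_of_nonneg_right (hg 𝔭 hp) (Nat.cast_nonneg _)
  have hinv : ∀ 𝔭 : HeightOneSpectrum (𝓞 K), (Ideal.absNorm 𝔭.asIdeal : ℝ)⁻¹ ≤ 1 / 2 := by
    intro 𝔭
    rw [one_div]
    exact inv_anti₀ (by norm_num) (hN 𝔭)
  have hs1 := hasSum_indicator_supportedIdeals (h := fun 𝔞 => g 𝔞 / Ideal.absNorm 𝔞)
    (by simp [g1]) (fun 𝔞 𝔟 ha hb => by rw [gmul _ _ ha hb, map_mul]; push_cast; ring) B
    (fun 𝔭 hp => (habs 𝔭 hp).trans_lt (by linarith [hinv 𝔭]))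
  -- As σ ≤ 1/2, the factor is at most 2^(-1/2). So 1 - t ≥ 1/4, and with t ≤ 3/N(𝔭), from N(𝔭)^σ ≤
  -- y^σ ≤ e, this yields the constant 12.
  have ht34 : ∀ 𝔭 : HeightOneSpectrum (𝓞 K),
      (Ideal.absNorm 𝔭.asIdeal : ℝ) ^ (σ - 1) ≤ 3 / 4 := by
    intro 𝔭
    have h0 : (0 : ℝ) < Ideal.absNorm 𝔭.asIdeal := by linarith [hN 𝔭]
    calc (Ideal.absNorm 𝔭.asIdeal : ℝ) ^ (σ - 1) ≤ (Ideal.absNorm 𝔭.asIdeal : ℝ) ^ (-(1 / 2) : ℝ) :=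
          Real.rpow_le_rpow_of_exponent_le (by linarith [hN 𝔭]) (by linarith)
      _ ≤ (2 : ℝ) ^ (-(1 / 2) : ℝ) :=
          Real.rpow_le_rpow_of_nonpos (by norm_num) (hN 𝔭) (by norm_num)
      _ ≤ 3 / 4 := by
          rw [Real.rpow_neg (by norm_num), ← Real.sqrt_eq_rpow]
          rw [inv_le_comm₀ (by positivity) (by norm_num)]
          exact Real.le_sqrt_of_sq_le (by norm_num)
  have hs2 := hasSum_indicator_supportedIdeals
    (h := fun 𝔞 => (Ideal.absNorm 𝔞 : ℝ) ^ (σ - 1))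
    (by simp) (fun 𝔞 𝔟 _ _ => by
      rw [map_mul, Nat.cast_mul, Real.mul_rpow (Nat.cast_nonneg _) (Nat.cast_nonneg _)]) B
    (fun 𝔭 _ => by
      rw [abs_of_nonneg (by positivity)]
      linarith [ht34 𝔭])
  have hR : ∏ 𝔭 ∈ B, (1 - (Ideal.absNorm 𝔭.asIdeal : ℝ) ^ (σ - 1))⁻¹ ≤
      Real.exp (12 * primeRecipSum K y) := by
    rw [primeRecipSum, mul_sum, Real.exp_sum]
    refine prod_le_prod (fun 𝔭 _ => inv_nonneg.2 (by linarith [ht34 𝔭])) fun 𝔭 hp => ?_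
    have h0 : (0 : ℝ) < Ideal.absNorm 𝔭.asIdeal := by linarith [hN 𝔭]
    set t := (Ideal.absNorm 𝔭.asIdeal : ℝ) ^ (σ - 1) with ht
    have ht0 : 0 ≤ t := by positivity
    have ht3 := ht34 𝔭
    have hte : t ≤ 3 * (Ideal.absNorm 𝔭.asIdeal : ℝ)⁻¹ := by
      rw [ht, sub_eq_add_neg, Real.rpow_add h0, Real.rpow_neg_one]
      refine mul_le_mul_of_nonneg_right ?_ (by positivity)
      rw [Real.rpow_def_of_pos h0]
      have hl : Real.log (Ideal.absNorm 𝔭.asIdeal) ≤ Real.log y :=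
        Real.log_le_log h0 (mem_primesOfNormLE.1 hp)
      calc _ ≤ Real.exp 1 := Real.exp_le_exp.2 (by nlinarith)
        _ ≤ 3 := by linarith [Real.exp_one_lt_d9]
    calc (1 - t)⁻¹ = t / (1 - t) + 1 := by
          have : 1 - t ≠ 0 := by linarith
          field_simp; ring
      _ ≤ Real.exp (t / (1 - t)) := Real.add_one_le_exp _
      _ ≤ Real.exp (12 * (Ideal.absNorm 𝔭.asIdeal : ℝ)⁻¹) := by
          refine Real.exp_le_exp.2 ?_
          rw [div_le_iff₀ (by linarith)]
          nlinarith
  have hE : Real.exp (-primeRecipSum K y) ≤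
      ∏ 𝔭 ∈ B, (1 - g 𝔭.asIdeal / Ideal.absNorm 𝔭.asIdeal)⁻¹ := by
    rw [primeRecipSum, ← sum_neg_distrib, Real.exp_sum]
    refine prod_le_prod (fun 𝔭 _ => (Real.exp_pos _).le) fun 𝔭 hp => ?_
    have h1 := abs_le.1 (habs 𝔭 hp)
    have h2 := hinv 𝔭
    rw [Real.exp_neg]
    refine inv_anti₀ (by linarith) ?_
    linarith [Real.add_one_le_exp ((Ideal.absNorm 𝔭.asIdeal : ℝ)⁻¹)]
  classical
  have hs3 : HasSum (fun 𝔞 => if 𝔞 ∈ supportedIdealsLE B x then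
      g 𝔞 / Ideal.absNorm 𝔞 else 0) (∑ 𝔞 ∈ supportedIdealsLE B x, g 𝔞 / Ideal.absNorm 𝔞) := by
    have := hasSum_sum_of_ne_finset_zero
      (s := supportedIdealsLE B x)
      (f := fun 𝔞 => if 𝔞 ∈ supportedIdealsLE B x then
      g 𝔞 / Ideal.absNorm 𝔞 else 0) (L := .unconditional _) (fun 𝔞 h => if_neg h)
    convert this using 1
    exact sum_congr rfl fun 𝔞 h => (if_pos h).symm
  -- Termwise: when N(𝔞) > x, g(𝔞)/N(𝔞) ≤ 1/N(𝔞) ≤ x^(-σ) N(𝔞)^(σ-1). The full Euler product is thus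
  -- at most the truncated sum plus x^(-σ) times the product at exponent 1 - σ.
  have hcmp := hasSum_le (fun 𝔞 => ?_) hs1 (hs3.add (hs2.mul_left (x ^ (-σ))))
  · have hx' : 0 ≤ x ^ (-σ) := by positivity
    nlinarith [mul_le_mul_of_nonneg_left hR hx']
  · by_cases ha : 𝔞 ∈ supportedIdeals B
    · rw [Set.indicator_of_mem ha, Set.indicator_of_mem ha]
      have hpos : (0 : ℝ) < Ideal.absNorm 𝔞 := by exact_mod_cast absNorm_pos_of_ne_bot ha.1
      have hnn : 0 ≤ x ^ (-σ) * (Ideal.absNorm 𝔞 : ℝ) ^ (σ - 1) := by positivity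
      by_cases hax : (Ideal.absNorm 𝔞 : ℝ) ≤ x
      · rw [if_pos (mem_supportedIdealsLE.2 ⟨mem_idealsOfNormLE.2 ⟨ha.1, hax⟩, ha⟩)]
        linarith
      · rw [if_neg (fun h => hax (mem_idealsOfNormLE.1 (mem_supportedIdealsLE.1 h).1).2), zero_add]
        calc g 𝔞 / Ideal.absNorm 𝔞 ≤ 1 / Ideal.absNorm 𝔞 :=
              div_le_div_of_nonneg_right ((le_abs_self _).trans (hgx 𝔞 ha)) hpos.le
          _ = (Ideal.absNorm 𝔞 : ℝ) ^ (-σ) * (Ideal.absNorm 𝔞 : ℝ) ^ (σ - 1) := by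
              rw [← Real.rpow_add hpos, show -σ + (σ - 1) = -1 by ring, Real.rpow_neg_one, one_div]
          _ ≤ _ := by
              refine mul_le_mul_of_nonneg_right ?_ (by positivity)
              exact Real.rpow_le_rpow_of_nonpos hx (not_le.1 hax).le (by linarith)
    · rw [Set.indicator_of_notMem ha, Set.indicator_of_notMem ha,
        if_neg (fun h => ha (mem_supportedIdealsLE.1 h).2)]
      simp

end EulerProduct

/-! ### The effect of adding one prime. -/

section Decomposition

variable {K : Type*} [Field K] [NumberField K]

/-- The exponent of `𝔭` in `𝔞` (zero if `𝔞 = ⊥`). -/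
noncomputable def ordAt (𝔭 : HeightOneSpectrum (𝓞 K)) (𝔞 : Ideal (𝓞 K)) : ℕ :=
  open Classical in if h : 𝔞 ≠ ⊥ then (exists_eq_asIdeal_pow_mul 𝔭 h).choose else 0

/-- The part of `𝔞` prime to `𝔭` (the unit ideal if `𝔞 = ⊥`). -/
noncomputable def primeToPart (𝔭 : HeightOneSpectrum (𝓞 K)) (𝔞 : Ideal (𝓞 K)) : Ideal (𝓞 K) :=
  open Classical in if h : 𝔞 ≠ ⊥ then (exists_eq_asIdeal_pow_mul 𝔭 h).choose_spec.choose else ⊤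

theorem pow_ordAt_mul_primeToPart (𝔭 : HeightOneSpectrum (𝓞 K)) {𝔞 : Ideal (𝓞 K)} (h : 𝔞 ≠ ⊥) :
    𝔞 = 𝔭.asIdeal ^ ordAt 𝔭 𝔞 * primeToPart 𝔭 𝔞 ∧ ¬ 𝔭.asIdeal ∣ primeToPart 𝔭 𝔞 ∧
      primeToPart 𝔭 𝔞 ≠ ⊥ := by
  have := (exists_eq_asIdeal_pow_mul 𝔭 h).choose_spec.choose_spec
  rw [ordAt, primeToPart, dif_pos h, dif_pos h]
  exact this

theorem sum_inv_absNorm_dvd_le {𝔠 : Ideal (𝓞 K)} (hc : 𝔠 ≠ ⊥) (x : ℝ)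
    (s : Finset (Ideal (𝓞 K))) (hs : ∀ 𝔞 ∈ s, 𝔞 ∈ idealsOfNormLE K x ∧ 𝔠 ∣ 𝔞) :
    ∑ 𝔞 ∈ s, (Ideal.absNorm 𝔞 : ℝ)⁻¹ ≤
      (Ideal.absNorm 𝔠 : ℝ)⁻¹ * ∑ 𝔟 ∈ idealsOfNormLE K x, (Ideal.absNorm 𝔟 : ℝ)⁻¹ := by
  classical
  have hinj : Set.InjOn (fun 𝔟 => 𝔠 * 𝔟) (idealsOfNormLE K x : Set (Ideal (𝓞 K))) :=
    fun a _ b _ h => mul_left_cancel₀ hc h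
  calc ∑ 𝔞 ∈ s, (Ideal.absNorm 𝔞 : ℝ)⁻¹
      ≤ ∑ 𝔞 ∈ (idealsOfNormLE K x).image (fun 𝔟 => 𝔠 * 𝔟), (Ideal.absNorm 𝔞 : ℝ)⁻¹ := by
        refine sum_le_sum_of_subset_of_nonneg (fun 𝔞 ha => ?_) fun _ _ _ => by positivity
        obtain ⟨h1, 𝔟, rfl⟩ := hs 𝔞 ha
        refine mem_image_of_mem _ ?_
        rw [mem_idealsOfNormLE] at h1 ⊢
        refine ⟨right_ne_zero_of_mul h1.1, le_trans ?_ h1.2⟩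
        exact_mod_cast absNorm_le_of_dvd h1.1 (dvd_mul_left _ _)
    _ = _ := by
        rw [sum_image hinj, mul_sum]
        refine sum_congr rfl fun 𝔟 _ => ?_
        rw [map_mul, Nat.cast_mul, mul_inv]

open Classical in
/-- The ideals of `supportedIdealsLE (insert 𝔭 T) x` divisible by an odd power of `𝔭` exactly. -/
noncomputable def oddPart (𝔭 : HeightOneSpectrum (𝓞 K)) (T : Finset (HeightOneSpectrum (𝓞 K)))
    (x : ℝ) : Finset (Ideal (𝓞 K)) :=
  (supportedIdealsLE (insert 𝔭 T) x).filter fun 𝔞 => Odd (ordAt 𝔭 𝔞)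

open Classical in
/-- The ideals of `supportedIdealsLE (insert 𝔭 T) x` divisible by a positive even power of `𝔭`
exactly. -/
noncomputable def evenPart (𝔭 : HeightOneSpectrum (𝓞 K)) (T : Finset (HeightOneSpectrum (𝓞 K)))
    (x : ℝ) : Finset (Ideal (𝓞 K)) :=
  (supportedIdealsLE (insert 𝔭 T) x).filter fun 𝔞 => ¬ Odd (ordAt 𝔭 𝔞) ∧ ordAt 𝔭 𝔞 ≠ 0

theorem primeToPart_mem_supportedIdeals [DecidableEq (HeightOneSpectrum (𝓞 K))]
    {𝔭 : HeightOneSpectrum (𝓞 K)}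
    {T : Finset (HeightOneSpectrum (𝓞 K))} {x : ℝ} {𝔞 : Ideal (𝓞 K)}
    (h : 𝔞 ∈ supportedIdealsLE (insert 𝔭 T) x) : primeToPart 𝔭 𝔞 ∈ supportedIdeals T := by
  have h2 := (mem_supportedIdealsLE.1 h).2
  obtain ⟨h3, h4, -⟩ := pow_ordAt_mul_primeToPart 𝔭 h2.1
  rw [h3] at h2
  exact mem_supportedIdeals_of_pow_mul h4 h2

-- Ideals are sorted by their exponent at 𝔭; as g(𝔭) = ±1, only its parity matters. The odd part
-- carries the sign g(𝔭); the even part has no such cancellation, but is divisible by 𝔭² and so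
-- smaller by a further factor N(𝔭).
open Classical in
theorem sum_supportedIdealsLE_insert {𝔭 : HeightOneSpectrum (𝓞 K)}
    {T : Finset (HeightOneSpectrum (𝓞 K))} (hT : 𝔭 ∉ T) (x : ℝ) {g : Ideal (𝓞 K) → ℝ}
    (g1 : g ⊤ = 1) (gmul : ∀ 𝔞 𝔟, 𝔞 ≠ ⊥ → 𝔟 ≠ ⊥ → g (𝔞 * 𝔟) = g 𝔞 * g 𝔟)
    (hg : g 𝔭.asIdeal = 1 ∨ g 𝔭.asIdeal = -1) :
    ∑ 𝔞 ∈ supportedIdealsLE (insert 𝔭 T) x, g 𝔞 / Ideal.absNorm 𝔞 =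
      ∑ 𝔞 ∈ supportedIdealsLE T x, g 𝔞 / Ideal.absNorm 𝔞 +
      g 𝔭.asIdeal * ∑ 𝔞 ∈ oddPart 𝔭 T x, g (primeToPart 𝔭 𝔞) / Ideal.absNorm 𝔞 +
      ∑ 𝔞 ∈ evenPart 𝔭 T x, g (primeToPart 𝔭 𝔞) / Ideal.absNorm 𝔞 := by
  have hgp : ∀ 𝔞 : Ideal (𝓞 K), 𝔞 ≠ ⊥ →
      g 𝔞 = g 𝔭.asIdeal ^ ordAt 𝔭 𝔞 * g (primeToPart 𝔭 𝔞) := by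
    intro 𝔞 ha
    obtain ⟨h1, h2, h3⟩ := pow_ordAt_mul_primeToPart 𝔭 ha
    conv_lhs => rw [h1]
    rw [gmul _ _ (pow_ne_zero _ 𝔭.prime.ne_zero) h3, map_pow_of_map_mul g1 gmul 𝔭.prime.ne_zero]
  have hne : ∀ 𝔞 ∈ supportedIdealsLE (insert 𝔭 T) x, 𝔞 ≠ ⊥ :=
    fun 𝔞 h => (mem_supportedIdealsLE.1 h).2.1
  have hzero : (supportedIdealsLE (insert 𝔭 T) x).filter (fun 𝔞 => ¬ Odd (ordAt 𝔭 𝔞) ∧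
      ¬ ordAt 𝔭 𝔞 ≠ 0) = supportedIdealsLE T x := by
    ext 𝔞
    simp only [mem_filter, not_not]
    constructor
    · rintro ⟨h1, -, h2⟩
      have h3 := primeToPart_mem_supportedIdeals h1
      have h4 := (pow_ordAt_mul_primeToPart 𝔭 (hne 𝔞 h1)).1
      rw [h2, pow_zero, one_mul] at h4
      rw [← h4] at h3
      exact mem_supportedIdealsLE.2 ⟨(mem_supportedIdealsLE.1 h1).1, h3⟩
    · intro h
      obtain ⟨h1, h2⟩ := mem_supportedIdealsLE.1 h
      have h0 : ordAt 𝔭 𝔞 = 0 := by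
        by_contra h0
        refine hT (h2.2 𝔭 ?_)
        rw [(pow_ordAt_mul_primeToPart 𝔭 h2.1).1]
        exact (dvd_pow_self _ h0).mul_right _
      exact ⟨mem_supportedIdealsLE.2 ⟨h1, h2.1, fun 𝔮 hq => mem_insert_of_mem (h2.2 𝔮 hq)⟩,
        by simp [h0], h0⟩
  have hsplit := sum_filter_add_sum_filter_not (supportedIdealsLE (insert 𝔭 T) x)
    (fun 𝔞 => Odd (ordAt 𝔭 𝔞)) (fun 𝔞 => g 𝔞 / Ideal.absNorm 𝔞)
  have hsplit2 := sum_filter_add_sum_filter_not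
    ((supportedIdealsLE (insert 𝔭 T) x).filter fun 𝔞 => ¬ Odd (ordAt 𝔭 𝔞))
    (fun 𝔞 => ordAt 𝔭 𝔞 ≠ 0) (fun 𝔞 => g 𝔞 / Ideal.absNorm 𝔞)
  rw [filter_filter, filter_filter, hzero] at hsplit2
  have hodd : ∑ 𝔞 ∈ supportedIdealsLE (insert 𝔭 T) x with Odd (ordAt 𝔭 𝔞),
      g 𝔞 / Ideal.absNorm 𝔞 =
      g 𝔭.asIdeal * ∑ 𝔞 ∈ oddPart 𝔭 T x, g (primeToPart 𝔭 𝔞) / Ideal.absNorm 𝔞 := by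
    rw [mul_sum, oddPart]
    refine sum_congr (by congr!) fun 𝔞 ha => ?_
    obtain ⟨h1, h2⟩ := mem_filter.1 ha
    have hpow : g 𝔭.asIdeal ^ ordAt 𝔭 𝔞 = g 𝔭.asIdeal := by
      rcases hg with h | h <;> rw [h]
      · exact one_pow _
      · exact h2.neg_one_pow
    rw [hgp 𝔞 (hne 𝔞 h1), hpow, mul_div_assoc]
  have heven : ∑ 𝔞 ∈ supportedIdealsLE (insert 𝔭 T) x with
      ¬ Odd (ordAt 𝔭 𝔞) ∧ ordAt 𝔭 𝔞 ≠ 0, g 𝔞 / Ideal.absNorm 𝔞 =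
      ∑ 𝔞 ∈ evenPart 𝔭 T x, g (primeToPart 𝔭 𝔞) / Ideal.absNorm 𝔞 := by
    rw [evenPart]
    refine sum_congr (by congr!) fun 𝔞 ha => ?_
    obtain ⟨h1, h2, -⟩ := mem_filter.1 ha
    have hpow : g 𝔭.asIdeal ^ ordAt 𝔭 𝔞 = 1 := by
      rcases hg with h | h <;> rw [h]
      · exact one_pow _
      · exact (Nat.not_odd_iff_even.1 h2).neg_one_pow
    rw [hgp 𝔞 (hne 𝔞 h1), hpow, one_mul]
  linarith

theorem abs_sum_div_absNorm_le (s : Finset (Ideal (𝓞 K))) {g : Ideal (𝓞 K) → ℝ}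
    (hg : ∀ 𝔞 ∈ s, |g 𝔞| ≤ 1) :
    |∑ 𝔞 ∈ s, g 𝔞 / Ideal.absNorm 𝔞| ≤ ∑ 𝔞 ∈ s, (Ideal.absNorm 𝔞 : ℝ)⁻¹ := by
  refine (abs_sum_le_sum_abs _ _).trans (sum_le_sum fun 𝔞 ha => ?_)
  rw [abs_div, Nat.abs_cast, ← one_div]
  exact div_le_div_of_nonneg_right (hg 𝔞 ha) (Nat.cast_nonneg _)

theorem sum_oddPart_inv_absNorm_le (𝔭 : HeightOneSpectrum (𝓞 K))
    (T : Finset (HeightOneSpectrum (𝓞 K))) (x : ℝ) :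
    ∑ 𝔞 ∈ oddPart 𝔭 T x, (Ideal.absNorm 𝔞 : ℝ)⁻¹ ≤ (Ideal.absNorm 𝔭.asIdeal : ℝ)⁻¹ *
      ∑ 𝔟 ∈ idealsOfNormLE K x, (Ideal.absNorm 𝔟 : ℝ)⁻¹ := by
  refine sum_inv_absNorm_dvd_le 𝔭.ne_bot x _ fun 𝔞 ha => ?_
  obtain ⟨h1, h2⟩ := mem_filter.1 ha
  obtain ⟨h3, h4⟩ := mem_supportedIdealsLE.1 h1
  refine ⟨h3, ?_⟩
  rw [(pow_ordAt_mul_primeToPart 𝔭 h4.1).1]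
  exact (dvd_pow_self _ h2.pos.ne').mul_right _

theorem sum_evenPart_inv_absNorm_le (𝔭 : HeightOneSpectrum (𝓞 K))
    (T : Finset (HeightOneSpectrum (𝓞 K))) (x : ℝ) :
    ∑ 𝔞 ∈ evenPart 𝔭 T x, (Ideal.absNorm 𝔞 : ℝ)⁻¹ ≤ ((Ideal.absNorm 𝔭.asIdeal : ℝ) ^ 2)⁻¹ *
      ∑ 𝔟 ∈ idealsOfNormLE K x, (Ideal.absNorm 𝔟 : ℝ)⁻¹ := by
  have h := sum_inv_absNorm_dvd_le (pow_ne_zero 2 𝔭.ne_bot) x (evenPart 𝔭 T x) fun 𝔞 ha => by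
    obtain ⟨h1, h2, h5⟩ := mem_filter.1 ha
    obtain ⟨h3, h4⟩ := mem_supportedIdealsLE.1 h1
    refine ⟨h3, ?_⟩
    rw [(pow_ordAt_mul_primeToPart 𝔭 h4.1).1]
    obtain ⟨r, hr⟩ := Nat.not_odd_iff_even.1 h2
    exact (pow_dvd_pow _ (by omega)).mul_right _
  simpa using h

end Decomposition

/-! ### Random signs, independence and measurability. -/

section Probability

open MeasureTheory ProbabilityTheory

/-- For ε = ±1, exp(-sεX) = cosh(sX) - ε sinh(sX). The second term has zero mean against Z by
independence, and cosh u ≤ exp(u²/2). This is the Hoeffding step, with Z the exponential of what has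
been accumulated so far. -/
theorem integral_mul_exp_rademacher_le {Ω : Type*} {m mΩ : MeasurableSpace Ω} (hm : m ≤ mΩ)
    {P : Measure Ω} [IsProbabilityMeasure P] {ε X Z : Ω → ℝ} (hε : Measurable ε)
    (hind : Indep (MeasurableSpace.comap ε inferInstance) m P)
    (hX : Measurable[m] X) (hZ : Measurable[m] Z)
    (hε1 : ∀ᵐ ω ∂P, ε ω = 1 ∨ ε ω = -1) (hE : ∫ ω, ε ω ∂P = 0) {c M s : ℝ}
    (hXc : ∀ᵐ ω ∂P, |X ω| ≤ c) (hZ0 : ∀ ω, 0 ≤ Z ω) (hZM : ∀ᵐ ω ∂P, Z ω ≤ M) :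
    Integrable (fun ω => Z ω * Real.exp (-s * (ε ω * X ω))) P ∧
    ∫ ω, Z ω * Real.exp (-s * (ε ω * X ω)) ∂P ≤
      Real.exp (s ^ 2 * c ^ 2 / 2) * ∫ ω, Z ω ∂P := by
  have hX' : Measurable X := hX.mono hm le_rfl
  have hZ' : Measurable Z := hZ.mono hm le_rfl
  have hcosh : ∀ᵐ ω ∂P, Real.cosh (s * X ω) ≤ Real.exp (s ^ 2 * c ^ 2 / 2) := by
    filter_upwards [hXc] with ω h
    refine (Real.cosh_le_exp_half_sq _).trans (Real.exp_le_exp.2 ?_)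
    have : X ω ^ 2 ≤ c ^ 2 := sq_le_sq' (by linarith [(abs_le.1 h).1]) (abs_le.1 h).2
    rw [mul_pow]
    nlinarith [sq_nonneg s]
  have hsinh : ∀ u : ℝ, |Real.sinh u| ≤ Real.cosh u := by
    intro u
    rw [Real.abs_sinh, ← Real.cosh_abs u]
    exact (Real.sinh_lt_cosh _).le
  have hIZ : Integrable Z P := Integrable.of_bound hZ'.aestronglyMeasurable M (by
    filter_upwards [hZM] with ω h
    rwa [Real.norm_of_nonneg (hZ0 ω)])
  have hIc : Integrable (fun ω => Z ω * Real.cosh (s * X ω)) P :=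
    Integrable.of_bound (by fun_prop) (M * Real.exp (s ^ 2 * c ^ 2 / 2)) (by
      filter_upwards [hZM, hcosh] with ω h1 h2
      rw [Real.norm_of_nonneg (mul_nonneg (hZ0 ω) (Real.cosh_pos _).le)]
      exact mul_le_mul h1 h2 (Real.cosh_pos _).le ((hZ0 ω).trans h1))
  have hIs : Integrable (fun ω => ε ω * (Z ω * Real.sinh (s * X ω))) P :=
    Integrable.of_bound (by fun_prop) (M * Real.exp (s ^ 2 * c ^ 2 / 2)) (by
      filter_upwards [hZM, hcosh, hε1] with ω h1 h2 h3
      have h4 : |ε ω| = 1 := by rcases h3 with h | h <;> simp [h]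
      rw [Real.norm_eq_abs, abs_mul, h4, one_mul, abs_mul, abs_of_nonneg (hZ0 ω)]
      exact mul_le_mul h1 ((hsinh _).trans h2) (abs_nonneg _) ((hZ0 ω).trans h1))
  have heq : (fun ω => Z ω * Real.exp (-s * (ε ω * X ω))) =ᵐ[P]
      fun ω => Z ω * Real.cosh (s * X ω) - ε ω * (Z ω * Real.sinh (s * X ω)) := by
    filter_upwards [hε1] with ω h
    have h5 : -s * (1 * X ω) = -(s * X ω) := by ring
    have h6 : -s * (-1 * X ω) = s * X ω := by ring
    rcases h with h | h <;> rw [h]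
    · rw [h5, ← Real.cosh_sub_sinh]; ring
    · rw [h6, ← Real.cosh_add_sinh]; ring
  have hprod : ∫ ω, ε ω * (Z ω * Real.sinh (s * X ω)) ∂P = 0 := by
    have hYm : Measurable[m] fun ω => Z ω * Real.sinh (s * X ω) :=
      hZ.mul (Real.measurable_sinh.comp (hX.const_mul s))
    have hif : IndepFun ε (fun ω => Z ω * Real.sinh (s * X ω)) P := by
      rw [IndepFun_iff_Indep]
      exact indep_of_indep_of_le_right hind hYm.comap_le
    have := hif.integral_mul_eq_mul_integral hε.aestronglyMeasurable
      (hYm.mono hm le_rfl).aestronglyMeasurable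
    simp only [Pi.mul_apply] at this
    rw [this, hE, zero_mul]
  refine ⟨(hIc.sub hIs).congr heq.symm, ?_⟩
  rw [integral_congr_ae heq, integral_sub hIc hIs, hprod, sub_zero, ← integral_const_mul]
  refine integral_mono_ae hIc (hIZ.const_mul _) ?_
  filter_upwards [hcosh] with ω h
  rw [mul_comm]
  exact mul_le_mul_of_nonneg_right h (hZ0 ω)

variable {K : Type*} [Field K] [NumberField K] {Ω : Type*} [mΩ : MeasurableSpace Ω]
  {P : Measure Ω} [IsProbabilityMeasure P] {f : Ideal (𝓞 K) → Ω → ℝ}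

theorem countable_heightOneSpectrum : Countable (HeightOneSpectrum (𝓞 K)) := by
  rw [← Set.countable_univ_iff]
  have : (Set.univ : Set (HeightOneSpectrum (𝓞 K))) =
      ⋃ N : ℕ, (primesOfNormLE K N : Set (HeightOneSpectrum (𝓞 K))) := by
    refine (Set.eq_univ_of_forall fun 𝔭 => Set.mem_iUnion.2 ⟨Ideal.absNorm 𝔭.asIdeal, ?_⟩).symm
    exact mem_coe.2 (mem_primesOfNormLE.2 le_rfl)
  rw [this]
  exact Set.countable_iUnion fun N => (finite_toSet _).countable

namespace IsRandomCompletelyMultiplicative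

theorem ae_eq_one_or_neg_one (hf : IsRandomCompletelyMultiplicative P f) :
    ∀ᵐ ω ∂P, ∀ 𝔭 : HeightOneSpectrum (𝓞 K), f 𝔭.asIdeal ω = 1 ∨ f 𝔭.asIdeal ω = -1 := by
  have := countable_heightOneSpectrum (K := K)
  rw [ae_all_iff]
  intro 𝔭
  have hm := hf.measurable_prime 𝔭
  have m1 : MeasurableSet {ω | f 𝔭.asIdeal ω = 1} := hm (measurableSet_singleton 1)
  have m2 : MeasurableSet {ω | f 𝔭.asIdeal ω = -1} := hm (measurableSet_singleton (-1))
  have hd : Disjoint {ω | f 𝔭.asIdeal ω = 1} {ω | f 𝔭.asIdeal ω = -1} := by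
    rw [Set.disjoint_left]
    intro ω h1 h2
    simp only [Set.mem_ofPred_eq] at h1 h2
    linarith
  have hu := measure_union (μ := P) hd m2
  rw [hf.prob_one, hf.prob_neg_one, ENNReal.add_halves] at hu
  have hc := (prob_compl_eq_zero_iff (m1.union m2)).2 hu
  exact hc

theorem integral_prime (hf : IsRandomCompletelyMultiplicative P f)
    (𝔭 : HeightOneSpectrum (𝓞 K)) : ∫ ω, f 𝔭.asIdeal ω ∂P = 0 := by
  have hm := hf.measurable_prime 𝔭
  have m1 : MeasurableSet {ω | f 𝔭.asIdeal ω = 1} := hm (measurableSet_singleton 1)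
  have m2 : MeasurableSet {ω | f 𝔭.asIdeal ω = -1} := hm (measurableSet_singleton (-1))
  have heq : f 𝔭.asIdeal =ᵐ[P] fun ω => {ω | f 𝔭.asIdeal ω = 1}.indicator (fun _ => (1 : ℝ)) ω -
      {ω | f 𝔭.asIdeal ω = -1}.indicator (fun _ => (1 : ℝ)) ω := by
    filter_upwards [hf.ae_eq_one_or_neg_one] with ω h
    have hne : (1 : ℝ) ≠ -1 := by norm_num
    rcases h 𝔭 with h | h <;> simp [h, hne, hne.symm]
  rw [integral_congr_ae heq, integral_sub, integral_indicator_const _ m1,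
    integral_indicator_const _ m2, measureReal_def, measureReal_def, hf.prob_one, hf.prob_neg_one]
  · simp
  · exact (integrable_const _).indicator m1
  · exact (integrable_const _).indicator m2

theorem ae_abs_eq_one (hf : IsRandomCompletelyMultiplicative P f) :
    ∀ᵐ ω ∂P, ∀ 𝔞 : Ideal (𝓞 K), 𝔞 ≠ ⊥ → |f 𝔞 ω| = 1 := by
  filter_upwards [hf.ae_eq_one_or_neg_one] with ω h 𝔞
  induction 𝔞 using UniqueFactorizationMonoid.induction_on_prime with
  | h₁ => exact fun h => absurd rfl h
  | h₂ 𝔲 hu =>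
    intro _
    rw [Ideal.isUnit_iff.1 hu, hf.map_unit, abs_one]
  | h₃ 𝔞 𝔭 ha hp ih =>
    intro _
    have hp0 := hp.ne_zero
    rw [hf.map_mul _ _ hp0 ha, abs_mul, ih ha, mul_one]
    rcases h ⟨𝔭, Ideal.isPrime_of_prime hp, hp0⟩ with h | h <;> simp only at h <;> simp [h]

end IsRandomCompletelyMultiplicative

/-- The `σ`-algebra generated by the values of `f` at the primes of `S`. -/
abbrev primeSigma (f : Ideal (𝓞 K) → Ω → ℝ) (S : Set (HeightOneSpectrum (𝓞 K))) :
    MeasurableSpace Ω :=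
  ⨆ 𝔭 ∈ S, MeasurableSpace.comap (f 𝔭.asIdeal) inferInstance

theorem primeSigma_mono (f : Ideal (𝓞 K) → Ω → ℝ) {S T : Set (HeightOneSpectrum (𝓞 K))}
    (h : S ⊆ T) : primeSigma f S ≤ primeSigma f T :=
  biSup_mono h

namespace IsRandomCompletelyMultiplicative

theorem primeSigma_le (hf : IsRandomCompletelyMultiplicative P f)
    (S : Set (HeightOneSpectrum (𝓞 K))) : primeSigma f S ≤ mΩ :=
  iSup₂_le fun 𝔭 _ => (hf.measurable_prime 𝔭).comap_le

theorem indep_primeSigma (hf : IsRandomCompletelyMultiplicative P f)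
    {𝔭 : HeightOneSpectrum (𝓞 K)} {S : Set (HeightOneSpectrum (𝓞 K))} (h : 𝔭 ∉ S) :
    Indep (MeasurableSpace.comap (f 𝔭.asIdeal) inferInstance) (primeSigma f S) P := by
  have := indep_iSup_of_disjoint (m := fun 𝔭 : HeightOneSpectrum (𝓞 K) =>
    MeasurableSpace.comap (f 𝔭.asIdeal) inferInstance)
    (fun 𝔭 => (hf.measurable_prime 𝔭).comap_le) hf.indep (Set.disjoint_singleton_left.2 h)
  simpa using this

/-- Induction on the factorisation of 𝔞. Measurability with respect to the primes of T alone makes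
sums over ideals supported on T independent of f(𝔭) for 𝔭 ∉ T. -/
theorem measurable_primeSigma (hf : IsRandomCompletelyMultiplicative P f)
    {T : Finset (HeightOneSpectrum (𝓞 K))} {𝔞 : Ideal (𝓞 K)} (h : 𝔞 ∈ supportedIdeals T) :
    Measurable[primeSigma f T] (f 𝔞) := by
  induction 𝔞 using UniqueFactorizationMonoid.induction_on_prime with
  | h₁ => exact absurd rfl h.1
  | h₂ 𝔲 hu =>
    have : f 𝔲 = fun _ => 1 := by
      funext ω
      rw [Ideal.isUnit_iff.1 hu, hf.map_unit]
    rw [this]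
    exact measurable_const
  | h₃ 𝔞 𝔭 ha hp ih =>
    have hp0 := hp.ne_zero
    have : f (𝔭 * 𝔞) = fun ω => f 𝔭 ω * f 𝔞 ω := funext fun ω => hf.map_mul _ _ hp0 ha ω
    rw [this]
    let 𝔮 : HeightOneSpectrum (𝓞 K) := ⟨𝔭, Ideal.isPrime_of_prime hp, hp0⟩
    have hq : 𝔮 ∈ T := h.2 𝔮 (dvd_mul_right _ _)
    have hm : Measurable[primeSigma f T] (f 𝔭) := by
      refine measurable_iff_comap_le.2 ?_
      exact le_iSup₂ (f := fun (𝔭 : HeightOneSpectrum (𝓞 K)) (_ : 𝔭 ∈ (T : Set _)) =>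
        MeasurableSpace.comap (f 𝔭.asIdeal) inferInstance) 𝔮 hq
    exact hm.mul (ih ⟨ha, fun 𝔯 hr => h.2 𝔯 (hr.mul_left _)⟩)

theorem measurable_sum (hf : IsRandomCompletelyMultiplicative P f)
    {T : Finset (HeightOneSpectrum (𝓞 K))} (s : Finset (Ideal (𝓞 K)))
    (φ : Ideal (𝓞 K) → Ideal (𝓞 K)) (h : ∀ 𝔞 ∈ s, φ 𝔞 ∈ supportedIdeals T) :
    Measurable[primeSigma f T] fun ω => ∑ 𝔞 ∈ s, f (φ 𝔞) ω / Ideal.absNorm 𝔞 :=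
  Finset.measurable_sum _ fun 𝔞 ha => (hf.measurable_primeSigma (h 𝔞 ha)).div_const _

end IsRandomCompletelyMultiplicative

end Probability

/-! ### Exponential moments and the Chernoff bound. -/

section Concentration

open MeasureTheory ProbabilityTheory

variable {K : Type*} [Field K] [NumberField K] {Ω : Type*} [mΩ : MeasurableSpace Ω]
  {P : Measure Ω} [IsProbabilityMeasure P] {f : Ideal (𝓞 K) → Ω → ℝ}

/-- The part of the weighted partial sum of `f` over ideals composed of primes in `T`. -/
noncomputable def supportedPartialSum (f : Ideal (𝓞 K) → Ω → ℝ) (x : ℝ)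
    (T : Finset (HeightOneSpectrum (𝓞 K))) (ω : Ω) : ℝ :=
  ∑ 𝔞 ∈ supportedIdealsLE T x, f 𝔞 ω / Ideal.absNorm 𝔞

theorem supportedPartialSum_primesOfNormLE (f : Ideal (𝓞 K) → Ω → ℝ) (x : ℝ) (ω : Ω) :
    supportedPartialSum f x (primesOfNormLE K x) ω = weightedPartialSum (fun 𝔞 => f 𝔞 ω) x := by
  refine sum_congr ?_ fun _ _ => rfl
  ext 𝔞
  rw [mem_supportedIdealsLE]
  exact ⟨fun h => h.1, fun h => ⟨h, mem_supportedIdeals_primesOfNormLE h⟩⟩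

namespace IsRandomCompletelyMultiplicative

theorem measurable_supportedPartialSum (hf : IsRandomCompletelyMultiplicative P f) (x : ℝ)
    (T : Finset (HeightOneSpectrum (𝓞 K))) :
    Measurable[primeSigma f T] (supportedPartialSum f x T) :=
  hf.measurable_sum _ id fun _ h => (mem_supportedIdealsLE.1 h).2

theorem ae_abs_supportedPartialSum_le (hf : IsRandomCompletelyMultiplicative P f) {x L : ℝ}
    (hL : ∑ 𝔞 ∈ idealsOfNormLE K x, (Ideal.absNorm 𝔞 : ℝ)⁻¹ ≤ L) :
    ∀ᵐ ω ∂P, ∀ T, |supportedPartialSum f x T ω| ≤ L := by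
  filter_upwards [hf.ae_abs_eq_one] with ω h T
  refine (abs_sum_div_absNorm_le (g := fun 𝔞 => f 𝔞 ω) _ fun 𝔞 ha =>
    (h 𝔞 (mem_supportedIdealsLE.1 ha).2.1).le).trans (le_trans ?_ hL)
  exact sum_le_sum_of_subset_of_nonneg (fun 𝔞 ha => (mem_supportedIdealsLE.1 ha).1)
    fun _ _ _ => by positivity

open Classical in
/-- An exponential moment bound for the contribution of the primes in `T` to the partial sum. -/
theorem integral_exp_supportedPartialSum_le (hf : IsRandomCompletelyMultiplicative P f)
    {x L s : ℝ} (hs : 0 ≤ s) (hL : ∑ 𝔞 ∈ idealsOfNormLE K x, (Ideal.absNorm 𝔞 : ℝ)⁻¹ ≤ L)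
    (B T : Finset (HeightOneSpectrum (𝓞 K))) (hBT : Disjoint B T) :
    ∫ ω, Real.exp (-s * (supportedPartialSum f x (B ∪ T) ω - supportedPartialSum f x B ω)) ∂P ≤
      Real.exp ((s * L + s ^ 2 * L ^ 2 / 2) *
        ∑ 𝔭 ∈ T, ((Ideal.absNorm 𝔭.asIdeal : ℝ) ^ 2)⁻¹) := by
  induction T using Finset.induction_on with
  | empty => simp
  | insert 𝔭 T hT ih =>
    have hB : 𝔭 ∉ B := fun h => (disjoint_left.1 hBT h) (mem_insert_self _ _)
    have ih' := ih (disjoint_of_subset_right (subset_insert _ _) hBT)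
    have hU : 𝔭 ∉ B ∪ T := by simp [hB, hT]
    set N : ℝ := (Ideal.absNorm 𝔭.asIdeal : ℝ) with hN
    have hN0 : 0 < N := by
      have := two_le_absNorm 𝔭
      rw [hN]; positivity
    have hL0 : 0 ≤ L := le_trans (sum_nonneg fun _ _ => by positivity) hL
    set Z : Ω → ℝ := fun ω =>
      Real.exp (-s * (supportedPartialSum f x (B ∪ T) ω - supportedPartialSum f x B ω)) with hZ
    set X : Ω → ℝ := fun ω =>
      ∑ 𝔞 ∈ oddPart 𝔭 (B ∪ T) x, f (primeToPart 𝔭 𝔞) ω / Ideal.absNorm 𝔞 with hX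
    set R : Ω → ℝ := fun ω =>
      ∑ 𝔞 ∈ evenPart 𝔭 (B ∪ T) x, f (primeToPart 𝔭 𝔞) ω / Ideal.absNorm 𝔞 with hR
    have hXm : Measurable[primeSigma f ((B ∪ T : Finset _) : Set _)] X :=
      hf.measurable_sum _ (primeToPart 𝔭) fun 𝔞 ha =>
        primeToPart_mem_supportedIdeals (mem_filter.1 ha).1
    have hZm : Measurable[primeSigma f ((B ∪ T : Finset _) : Set _)] Z := by
      have h1 := hf.measurable_supportedPartialSum x (B ∪ T)
      have h2 := (hf.measurable_supportedPartialSum x B).mono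
        (primeSigma_mono f (coe_subset.2 (subset_union_left (s₂ := T)))) le_rfl
      exact Real.measurable_exp.comp ((h1.sub h2).const_mul (-s))
    have hXc : ∀ᵐ ω ∂P, |X ω| ≤ N⁻¹ * L := by
      filter_upwards [hf.ae_abs_eq_one] with ω h
      refine (abs_sum_div_absNorm_le (g := fun 𝔞 => f (primeToPart 𝔭 𝔞) ω) _ fun 𝔞 ha =>
        (h _ ?_).le).trans ((sum_oddPart_inv_absNorm_le 𝔭 _ x).trans
          (mul_le_mul_of_nonneg_left hL (by positivity)))
      exact (primeToPart_mem_supportedIdeals (mem_filter.1 ha).1).1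
    have hRc : ∀ᵐ ω ∂P, |R ω| ≤ (N ^ 2)⁻¹ * L := by
      filter_upwards [hf.ae_abs_eq_one] with ω h
      refine (abs_sum_div_absNorm_le (g := fun 𝔞 => f (primeToPart 𝔭 𝔞) ω) _ fun 𝔞 ha =>
        (h _ ?_).le).trans ((sum_evenPart_inv_absNorm_le 𝔭 _ x).trans
          (mul_le_mul_of_nonneg_left hL (by positivity)))
      exact (primeToPart_mem_supportedIdeals (mem_filter.1 ha).1).1
    have hZM : ∀ᵐ ω ∂P, Z ω ≤ Real.exp (s * (2 * L)) := by
      filter_upwards [hf.ae_abs_supportedPartialSum_le hL] with ω h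
      refine Real.exp_le_exp.2 ?_
      have h1 := abs_le.1 (h (B ∪ T))
      have h2 := abs_le.1 (h B)
      nlinarith
    have hind := hf.indep_primeSigma (𝔭 := 𝔭) (S := ((B ∪ T : Finset _) : Set _))
      (fun h => hU (mem_coe.1 h))
    have hε : ∀ᵐ ω ∂P, f 𝔭.asIdeal ω = 1 ∨ f 𝔭.asIdeal ω = -1 :=
      hf.ae_eq_one_or_neg_one.mono fun ω h => h 𝔭
    have hZ0 : ∀ ω, 0 ≤ Z ω := fun ω => (Real.exp_pos _).le
    clear_value X R Z
    obtain ⟨hint, hle⟩ := integral_mul_exp_rademacher_le (hf.primeSigma_le _)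
      (hf.measurable_prime 𝔭) hind hXm hZm hε (hf.integral_prime 𝔭) (s := s) hXc hZ0 hZM
    -- The even part R is replaced by its worst-case bound; only the odd part is averaged over the
    -- new sign.
    have hdec : ∀ᵐ ω ∂P, Real.exp (-s * (supportedPartialSum f x (B ∪ insert 𝔭 T) ω -
        supportedPartialSum f x B ω)) ≤
        Real.exp (s * ((N ^ 2)⁻¹ * L)) * (Z ω * Real.exp (-s * (f 𝔭.asIdeal ω * X ω))) := by
      filter_upwards [hf.ae_eq_one_or_neg_one, hRc] with ω h1 h2
      have h3 := sum_supportedIdealsLE_insert hU x (g := fun 𝔞 => f 𝔞 ω) (hf.map_unit ω)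
        (fun 𝔞 𝔟 ha hb => hf.map_mul 𝔞 𝔟 ha hb ω) (h1 𝔭)
      have h4 : supportedPartialSum f x (B ∪ insert 𝔭 T) ω =
          supportedPartialSum f x (B ∪ T) ω + f 𝔭.asIdeal ω * X ω + R ω := by
        rw [union_insert, congrFun hX ω, congrFun hR ω]; exact h3
      rw [h4, congrFun hZ ω, ← Real.exp_add, ← Real.exp_add]
      refine Real.exp_le_exp.2 ?_
      have := mul_le_mul_of_nonneg_left (neg_le_of_abs_le h2) hs
      linarith
    calc _ ≤ ∫ ω, Real.exp (s * ((N ^ 2)⁻¹ * L)) *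
          (Z ω * Real.exp (-s * (f 𝔭.asIdeal ω * X ω))) ∂P :=
          integral_mono_of_nonneg (Filter.Eventually.of_forall fun ω => (Real.exp_pos _).le)
            (hint.const_mul _) hdec
      _ ≤ Real.exp (s * ((N ^ 2)⁻¹ * L)) *
          (Real.exp (s ^ 2 * (N⁻¹ * L) ^ 2 / 2) * Real.exp ((s * L + s ^ 2 * L ^ 2 / 2) *
            ∑ 𝔭 ∈ T, ((Ideal.absNorm 𝔭.asIdeal : ℝ) ^ 2)⁻¹)) := by
          rw [integral_const_mul]
          refine mul_le_mul_of_nonneg_left (hle.trans ?_) (Real.exp_pos _).le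
          exact mul_le_mul_of_nonneg_left ih' (Real.exp_pos _).le
      _ = _ := by
          rw [← Real.exp_add, ← Real.exp_add, sum_insert hT]
          congr 1
          rw [← hN]
          field_simp
          ring

/-- If the total is negative while the y-smooth part is at least t, the primes above y contribute
less than -t; Markov's inequality applies to the exponential. The sum of 1/N(𝔭)² over N(𝔭) > y loses
one factor to 1/y. -/
theorem prob_weightedPartialSum_neg_le (hf : IsRandomCompletelyMultiplicative P f)
    {x y L s t : ℝ} (hs : 0 ≤ s) (hy : 0 < y) (hyx : y ≤ x)
    (hL : ∑ 𝔞 ∈ idealsOfNormLE K x, (Ideal.absNorm 𝔞 : ℝ)⁻¹ ≤ L)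
    (ht : ∀ᵐ ω ∂P, t ≤ supportedPartialSum f x (primesOfNormLE K y) ω) :
    P.real {ω | weightedPartialSum (fun 𝔞 => f 𝔞 ω) x < 0} ≤
      Real.exp (-s * t + (s * L + s ^ 2 * L ^ 2 / 2) * (primeRecipSum K x / y)) := by
  classical
  set B := primesOfNormLE K y with hB
  set T := primesOfNormLE K x \ B with hT
  have hL0 : 0 ≤ L := le_trans (sum_nonneg fun _ _ => by positivity) hL
  have hU : B ∪ T = primesOfNormLE K x :=
    union_sdiff_of_subset (primesOfNormLE_mono hyx)
  have hmgf := hf.integral_exp_supportedPartialSum_le hs hL B T disjoint_sdiff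
  have hsumT : ∑ 𝔭 ∈ T, ((Ideal.absNorm 𝔭.asIdeal : ℝ) ^ 2)⁻¹ ≤ primeRecipSum K x / y := by
    calc _ ≤ ∑ 𝔭 ∈ T, (Ideal.absNorm 𝔭.asIdeal : ℝ)⁻¹ * y⁻¹ := by
          refine sum_le_sum fun 𝔭 hp => ?_
          have h1 : y < Ideal.absNorm 𝔭.asIdeal := by
            have := (mem_sdiff.1 hp).2
            rw [hB, mem_primesOfNormLE, not_le] at this
            exact this
          rw [sq, mul_inv]
          exact mul_le_mul_of_nonneg_left (inv_anti₀ hy h1.le) (by positivity)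
      _ = (∑ 𝔭 ∈ T, (Ideal.absNorm 𝔭.asIdeal : ℝ)⁻¹) / y := by rw [← sum_mul, div_eq_mul_inv]
      _ ≤ _ := by
          refine div_le_div_of_nonneg_right ?_ hy.le
          exact sum_le_sum_of_subset_of_nonneg sdiff_subset fun _ _ _ => by positivity
  rw [hU] at hmgf
  set F : Ω → ℝ := fun ω => Real.exp (-s * (supportedPartialSum f x (primesOfNormLE K x) ω -
    supportedPartialSum f x B ω)) with hF
  have hmeas : ∀ T', Measurable (supportedPartialSum f x T') := fun T' =>
    (hf.measurable_supportedPartialSum x T').mono (hf.primeSigma_le _) le_rfl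
  have hFm : Measurable F :=
    Real.measurable_exp.comp (((hmeas _).sub (hmeas _)).const_mul (-s))
  have hFi : Integrable F P := Integrable.of_bound hFm.aestronglyMeasurable
    (Real.exp (s * (2 * L))) (by
      filter_upwards [hf.ae_abs_supportedPartialSum_le hL] with ω h
      rw [Real.norm_of_nonneg (Real.exp_pos _).le]
      refine Real.exp_le_exp.2 ?_
      have h1 := abs_le.1 (h (primesOfNormLE K x))
      have h2 := abs_le.1 (h B)
      nlinarith)
  have hmarkov := mul_meas_ge_le_integral_of_nonneg
    (Filter.Eventually.of_forall fun ω => (Real.exp_pos _).le) hFi (Real.exp (s * t))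
  have hsub : P.real {ω | weightedPartialSum (fun 𝔞 => f 𝔞 ω) x < 0} ≤
      P.real {ω | Real.exp (s * t) ≤ F ω} := by
    refine ENNReal.toReal_mono (measure_ne_top _ _) (measure_mono_ae ?_)
    filter_upwards [ht] with ω h hω
    have hω' : supportedPartialSum f x (primesOfNormLE K x) ω < 0 := by
      rw [supportedPartialSum_primesOfNormLE]; exact hω
    refine Real.exp_le_exp.2 ?_
    nlinarith
  have hpos := Real.exp_pos (s * t)
  have hfin : Real.exp (s * t) * P.real {ω | weightedPartialSum (fun 𝔞 => f 𝔞 ω) x < 0} ≤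
      Real.exp ((s * L + s ^ 2 * L ^ 2 / 2) * (primeRecipSum K x / y)) := by
    refine (mul_le_mul_of_nonneg_left hsub hpos.le).trans (hmarkov.trans (hmgf.trans ?_))
    refine Real.exp_le_exp.2 (mul_le_mul_of_nonneg_left hsumT (by positivity))
  rw [Real.exp_add, neg_mul, Real.exp_neg, ← div_eq_inv_mul, le_div_iff₀ hpos, mul_comm]
  exact hfin

/-- The negativity probability, in terms of an upper bound for `∑ 1 / N(𝔭)`. -/
theorem prob_weightedPartialSum_neg_le_exp_neg_exp (hf : IsRandomCompletelyMultiplicative P f)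
    {x κ : ℝ} (hκ : 1 ≤ κ) (hx : 1 < x)
    (hlarge : 24 * (13 * κ + 1) * (3 * κ + 2) ≤ Real.log (Real.log x))
    (hS : primeRecipSum K x ≤ κ * Real.log (Real.log x)) :
    P.real {ω | weightedPartialSum (fun 𝔞 => f 𝔞 ω) x < 0} ≤
      Real.exp (-Real.exp (Real.log x / (4 * (13 * κ + 1) * Real.log (Real.log x)))) := by
  have hx0 : 0 < x := by linarith
  have hΛ0 : 0 < Real.log x := Real.log_pos hx
  have hxΛ : Real.exp (Real.log x) = x := Real.exp_log hx0
  have hΛl : Real.exp (Real.log (Real.log x)) = Real.log x := Real.exp_log hΛ0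
  set Λ := Real.log x with hΛ
  set l := Real.log Λ with hl
  -- Rankin's error is exp(-c l + 12 S) with S ≤ κ l, to be compared with exp(-S). This c leaves a
  -- factor exp(-l) ≤ 1/2.
  set c := 13 * κ + 1 with hc
  have hc1 : 14 ≤ c := by linarith
  have hl1 : 1 ≤ l := by nlinarith
  have hl0 : 0 < l := by linarith
  have hc0 : 0 < c := by linarith
  have hcl : 1 ≤ c * l := by nlinarith
  -- From Λ = exp l ≥ l³/6 and the lower bound on l; the constant 24 in that bound is 4 · 6.
  have hΛbig : 4 * c * (3 * κ + 2) * l ^ 2 ≤ Λ := by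
    have h := Real.pow_div_factorial_le_exp l hl0.le 3
    rw [hΛl] at h
    norm_num [Nat.factorial] at h
    have := mul_le_mul_of_nonneg_right hlarge (sq_nonneg l)
    nlinarith
  have hΛ2 : 2 * (c * l) ≤ Λ := by
    have h1 : l ≤ l ^ 2 := by nlinarith
    have h2 : 0 ≤ c * l ^ 2 := by positivity
    nlinarith [mul_le_mul_of_nonneg_left h1 hc0.le]
  -- The smoothness bound is y = w⁴, so the target is exp(-w). Below, E = Λ^κ bounds every other
  -- quantity up to powers, and w ≥ 6 E³.
  set w := Real.exp (Λ / (4 * c * l)) with hw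
  set E := Real.exp (κ * l) with hE
  have hκl : 0 < κ * l := by positivity
  have hE1 : 1 ≤ E := Real.one_le_exp hκl.le
  have hw4 : w ^ 4 = Real.exp (Λ / (c * l)) := by
    rw [hw, ← Real.exp_nat_mul]
    congr 1
    push_cast
    field_simp
  have hwE : 6 * E ^ 3 ≤ w := by
    have h6 : (6 : ℝ) ≤ Real.exp (2 * l) := by
      have h := Real.exp_one_gt_d9
      have h' : Real.exp 2 ≤ Real.exp (2 * l) := Real.exp_le_exp.2 (by linarith)
      have h'' : Real.exp 2 = Real.exp 1 * Real.exp 1 := by rw [← Real.exp_add]; norm_num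
      nlinarith
    calc 6 * E ^ 3 ≤ Real.exp (2 * l) * E ^ 3 := mul_le_mul_of_nonneg_right h6 (by positivity)
      _ = Real.exp ((3 * κ + 2) * l) := by
          rw [hE, ← Real.exp_nat_mul, ← Real.exp_add]
          congr 1
          push_cast
          ring
      _ ≤ w := by
          refine Real.exp_le_exp.2 ?_
          rw [le_div_iff₀ (by positivity)]
          linarith
  have hw1 : 1 ≤ w := by
    have := one_le_pow₀ hE1 (n := 3)
    linarith
  have hS0 : 0 ≤ primeRecipSum K x := primeRecipSum_nonneg x
  have hSE : primeRecipSum K x ≤ E := by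
    have := Real.add_one_le_exp (κ * l)
    linarith
  have hyx : w ^ 4 ≤ x := by
    rw [hw4]
    calc Real.exp (Λ / (c * l)) ≤ Real.exp Λ := Real.exp_le_exp.2 (div_le_self hΛ0.le hcl)
      _ = x := hxΛ
  have hSy : primeRecipSum K (w ^ 4) ≤ κ * l := (primeRecipSum_mono hyx).trans hS
  have hL : ∑ 𝔞 ∈ idealsOfNormLE K x, (Ideal.absNorm 𝔞 : ℝ)⁻¹ ≤ E ^ 2 := by
    refine (sum_inv_absNorm_le_exp x).trans ?_
    rw [hE, ← Real.exp_nat_mul]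
    exact Real.exp_le_exp.2 (by push_cast; linarith)
  have ht : ∀ᵐ ω ∂P, 1 / (2 * E) ≤ supportedPartialSum f x (primesOfNormLE K (w ^ 4)) ω := by
    filter_upwards [hf.ae_abs_eq_one] with ω h
    -- The Rankin exponent σ = c l / Λ is 1/log y, the largest allowed.
    have hmain := exp_neg_sub_le_sum_supportedIdeals (g := fun 𝔞 => f 𝔞 ω) (x := x) (y := w ^ 4)
      (σ := c * l / Λ) (hf.map_unit ω) (fun 𝔞 𝔟 ha hb => hf.map_mul 𝔞 𝔟 ha hb ω)
      (fun 𝔭 _ => (h _ 𝔭.ne_bot).le) (fun 𝔞 ha => (h _ ha.1).le) hx0 (by positivity)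
      (by rw [div_le_iff₀ hΛ0]; linarith)
      (by rw [hw4, Real.log_exp]; field_simp; exact le_rfl)
    refine le_trans ?_ hmain
    set S := primeRecipSum K (w ^ 4) with hSdef
    have h1 : x ^ (-(c * l / Λ)) = Real.exp (-(c * l)) := by
      rw [Real.rpow_def_of_pos hx0, ← hΛ]
      congr 1
      field_simp
    have h2 : Real.exp (-(c * l)) * Real.exp (12 * S) ≤ Real.exp (-l) * Real.exp (-S) := by
      rw [← Real.exp_add, ← Real.exp_add]
      refine Real.exp_le_exp.2 ?_
      rw [hc]
      linarith
    have h3 : Real.exp (-l) ≤ 1 / 2 := by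
      rw [Real.exp_neg, one_div]
      exact inv_anti₀ (by norm_num) (by linarith [Real.add_one_le_exp l])
    have h4 : E⁻¹ ≤ Real.exp (-S) := by
      rw [hE, ← Real.exp_neg]
      exact Real.exp_le_exp.2 (by linarith)
    have h5 : 1 / (2 * E) = E⁻¹ / 2 := by field_simp
    rw [h1, h5]
    nlinarith [mul_le_mul_of_nonneg_right h3 (Real.exp_pos (-S)).le]
  -- With s = √y the variance term s²L²/y is a power of E, and the gain s t = w²/(2E) still exceeds
  -- w + 2E⁵.
  refine (hf.prob_weightedPartialSum_neg_le (s := w ^ 2) (by positivity) (by positivity) hyx hL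
    ht).trans (Real.exp_le_exp.2 ?_)
  have hE0 : 0 < E := by linarith
  have hw0 : 0 < w := by linarith
  have e1 : (w ^ 2 * E ^ 2 + (w ^ 2) ^ 2 * (E ^ 2) ^ 2 / 2) * (primeRecipSum K x / w ^ 4) ≤
      2 * E ^ 5 := by
    calc _ = (E ^ 2 / w ^ 2 + E ^ 4 / 2) * primeRecipSum K x := by field_simp
      _ ≤ (E ^ 4 + E ^ 4 / 2) * E := by
          have h1 : E ^ 2 / w ^ 2 ≤ E ^ 4 :=
            (div_le_self (by positivity) (one_le_pow₀ hw1)).trans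
              (pow_le_pow_right₀ hE1 (by norm_num))
          gcongr
      _ ≤ 2 * E ^ 5 := by nlinarith [pow_pos hE0 5]
  have e2 : w + 2 * E ^ 5 ≤ w ^ 2 * (1 / (2 * E)) := by
    rw [mul_one_div, le_div_iff₀ (by positivity)]
    have h1 : E ≤ E ^ 3 := le_self_pow₀ hE1 (by norm_num)
    have h2 : 36 * E ^ 6 ≤ w ^ 2 := by
      calc 36 * E ^ 6 = (6 * E ^ 3) ^ 2 := by ring
        _ ≤ w ^ 2 := pow_le_pow_left₀ (by positivity) hwE 2
    have h3 : 6 * E * w ≤ w ^ 2 := by nlinarith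
    nlinarith [pow_pos hE0 6]
  linarith

end IsRandomCompletelyMultiplicative

end Concentration

end

/-! ### Choice of constants and conclusion. -/

theorem theorem1p1 :
    ∃ M : ℝ, 0 < M ∧ ∀ A : ℝ, 0 < A → ∃ C : ℝ, 0 < C ∧
      ∀ x : ℝ, 3 ≤ x → ∀ n : ℕ, 1 ≤ n → (n : ℝ) < Real.log x ^ A →
      ∀ (K : Type*) [Field K] [NumberField K] [IsCyclotomicExtension {n} ℚ K]
        (Ω : Type*) [MeasurableSpace Ω] (P : MeasureTheory.Measure Ω)
        [MeasureTheory.IsProbabilityMeasure P] (f : Ideal (𝓞 K) → Ω → ℝ),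
        IsRandomCompletelyMultiplicative P f →
        P.real {ω | weightedPartialSum (fun 𝔞 => f 𝔞 ω) x < 0} ≤
          M * Real.exp (-Real.exp (Real.log x / (C * Real.log (Real.log x)))) := by
  -- This M makes the bound at least 1, hence trivial, whenever Λ/(C l) ≤ 1.
  refine ⟨Real.exp (Real.exp 1), Real.exp_pos _, fun A hA => ?_⟩
  -- Absorbs 5 log n + 104 l + 350, using log n ≤ A l and l ≥ 1.
  set κ : ℝ := 5 * A + 454 with hκ
  set l₀ : ℝ := 24 * (13 * κ + 1) * (3 * κ + 2) with hl₀
  have hlog3 : 1 < Real.log 3 := by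
    rw [Real.lt_log_iff_exp_lt (by norm_num)]
    linarith [Real.exp_one_lt_d9]
  set l₃ : ℝ := Real.log (Real.log 3) with hl₃
  have hl₃0 : 0 < l₃ := Real.log_pos hlog3
  have hκ1 : 1 ≤ κ := by linarith
  have hquot : 0 < Real.exp l₀ / l₃ := by positivity
  -- The first summand serves l ≥ l₀. The second forces Λ ≤ C l when l < l₀, since then Λ < exp l₀
  -- and l ≥ l₃ > 0.
  set C : ℝ := 4 * (13 * κ + 1) + Real.exp l₀ / l₃ with hC
  have hC0 : 0 < C := by positivity
  refine ⟨C, hC0, fun x hx n hn hnx K _ _ _ Ω _ P _ f hf => ?_⟩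
  have hΛ3 : Real.log 3 ≤ Real.log x := Real.log_le_log (by norm_num) hx
  have hl3 : l₃ ≤ Real.log (Real.log x) := Real.log_le_log (by linarith) hΛ3
  set Λ := Real.log x with hΛ
  set l := Real.log Λ with hl
  have hl0 : 0 < l := by linarith
  have hΛ0 : 0 < Λ := by linarith
  rcases lt_or_ge l l₀ with hsmall | hbig
  · have h1 : Λ / (C * l) ≤ 1 := by
      rw [div_le_one (by positivity)]
      calc Λ = Real.exp l := (Real.exp_log hΛ0).symm
        _ ≤ Real.exp l₀ := Real.exp_le_exp.2 hsmall.le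
        _ = Real.exp l₀ / l₃ * l₃ := by field_simp
        _ ≤ C * l := mul_le_mul (by rw [hC]; linarith) hl3 hl₃0.le hC0.le
    calc P.real {ω | weightedPartialSum (fun 𝔞 => f 𝔞 ω) x < 0} ≤ 1 :=
          MeasureTheory.measureReal_le_one
      _ ≤ Real.exp (Real.exp 1) * Real.exp (-Real.exp (Λ / (C * l))) := by
          rw [← Real.exp_add]
          exact Real.one_le_exp (by linarith [Real.exp_le_exp.2 h1])
  · have hl1 : 1 ≤ l := by nlinarith
    have : NeZero n := ⟨by omega⟩
    have hlogn : Real.log n ≤ A * l := by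
      have h := Real.log_le_log (by positivity) hnx.le
      rwa [Real.log_rpow hΛ0] at h
    have hS : primeRecipSum K x ≤ κ * l := by
      refine (sum_inv_absNorm_cyclotomic_le n hx).trans ?_
      rw [hκ]
      linarith
    refine (hf.prob_weightedPartialSum_neg_le_exp_neg_exp hκ1 (by linarith) hbig hS).trans ?_
    have h1 : Λ / (C * l) ≤ Λ / (4 * (13 * κ + 1) * l) := by
      refine div_le_div_of_nonneg_left hΛ0.le (by positivity) ?_
      exact mul_le_mul_of_nonneg_right (by rw [hC]; linarith) hl0.le
    calc _ ≤ 1 * Real.exp (-Real.exp (Λ / (C * l))) := by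
          rw [one_mul]
          exact Real.exp_le_exp.2 (neg_le_neg (Real.exp_le_exp.2 h1))
      _ ≤ _ := mul_le_mul_of_nonneg_right (Real.one_le_exp (Real.exp_pos _).le) (Real.exp_pos _).le
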